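/- Let $H$ be a complex Hilbert space with an orthonormal basis $\{e_k:k\in\mathbb Z\}$ and symplectic form $\sigma(x,y)=\operatorname{Im}\langle x,y\rangle$ (inner product linear in the first variable). Let $\mathrm{CCR}(H,\sigma)$ be the universal C*-algebra generated by elements $W(x)$, $x\in H$, with $W(x)^*=W(-x)$ and $W(x)W(y)=e^{i\sigma(x,y)}W(x+y)$ (its unit is $W(0)$), and let $\mathfrak B_0\subset \mathrm{CCR}(H,\sigma)$ be the C*-subalgebra generated by the $W(x)$ with $x$ in the linear span $H_0$ of $\{e_k\}$. Let $\mathbb O_{\mathbb Z}$ be the group of all unitaries $O$ on $H$ with $\langle Oe_i,e_j\rangle\in\mathbb R$ for all $i,j$ and $Oe_i=e_i$ for all but finitely many $i$, acting on $\mathfrak B_0$ by automorphisms $\rho_O$ determined by $\rho_O(W(x))=W(Ox)$, $x\in H_0$. For $n\ge 1$ define $g_n:\mathbb Z\to\mathbb Z$ by $$g_n(k)=\begin{cases}k+2^{n-1},&0\le k<2^{n-1}\ \text{ or }\ -2^n\le k<-2^{n-1},\\ k-2^{n-1},&2^{n-1}\le k<2^n\ \text{ or }\ -2^{n-1}\le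 k\le -1,\\ k,&\text{otherwise.}\end{cases}$$ Then each $g_n$ is a finite permutation of $\mathbb Z$; denote also by $g_n\in\mathbb O_{\mathbb Z}$ the unitary $e_k\mapsto e_{g_n(k)}$. The following hold. 1. For all $a,b\in\mathfrak B_0$, $\ \lim_{n\to\infty}\|\rho_{g_n}(a)b-b\rho_{g_n}(a)\|=0$. In particular, $(\mathfrak B_0,\mathbb O_{\mathbb Z},\rho)$ is asymptotically abelian, i.e. some sequence in $\mathbb O_{\mathbb Z}$ has this property. 2. $(\mathfrak B_0,\mathbb O_{\mathbb Z},\rho)$ is $\mathbb O_{\mathbb Z}$-abelian: for every $\mathbb O_{\mathbb Z}$-invariant state $\omega$ on $\mathfrak B_0$, with GNS representation $\pi_\omega$ and with $E_\omega$ the orthogonal projection onto the vectors of the GNS space fixed by the unitaries canonically implementing the action (those fixing the GNS vector), the operators $E_\omega\pi_\omega(a)E_\omega$, $a\in\mathfrak B_0$, commute with each other. 3. The set of $\mathbb O_{\mathbb Z}$-invariant states on $\mathfrak B_0$, with the weak* topology, is a Choquet simplex: it is compact and convex, and, $P$ being the convex cone over it, the space $P-P$ ordered by $P$ is a vector lattice.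 -/

import Mathlib

open Filter Topology
open scoped ENNReal ComplexOrder InnerProductSpace

noncomputable section

universe u

/-! ### The CCR algebra of a real symplectic space -/

section CCR

variable {V : Type u} [AddCommGroup V] [Module ℝ V]

/-- A family of elements `W x` of a (nonzero, unital) C⋆-algebra satisfying the canonical
commutation relations in Weyl form over `(V, σ)`, with unit `W 0`. -/
structure WeylSystem (σ : LinearMap.BilinForm ℝ V) where
  carrier : Type u
  [cstar : CStarAlgebra carrier]
  [nontriv : Nontrivial carrier]
  W : V → carrier
  W_zero : W 0 = 1
  star_W : ∀ x, star (W x) = W (-x)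
  W_mul_W : ∀ x y, W x * W y = Complex.exp (Complex.I * (σ x y : ℂ)) • W (x + y)

attribute [instance] WeylSystem.cstar WeylSystem.nontriv

variable {σ : LinearMap.BilinForm ℝ V}

theorem WeylSystem.norm_W_le (w : WeylSystem σ) (x : V) : ‖w.W x‖ ≤ 1 := by
  have h : ‖w.W x‖ * ‖w.W x‖ = 1 := by
    rw [← CStarRing.norm_star_mul_self, w.star_W, w.W_mul_W, norm_smul, mul_comm Complex.I,
      Complex.norm_exp_ofReal_mul_I, neg_add_cancel, w.W_zero, norm_one, one_mul]
  nlinarith [norm_nonneg (w.W x)]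

/-- The Weyl system `x ↦ W (O x)`, for a linear `O` preserving `σ`. -/
def WeylSystem.precomp (w : WeylSystem σ) (O : V →ₗ[ℝ] V)
    (hO : ∀ x y, σ (O x) (O y) = σ x y) : WeylSystem σ where
  carrier := w.carrier
  W x := w.W (O x)
  W_zero := by simp [w.W_zero]
  star_W x := by simp [w.star_W]
  W_mul_W x y := by simp [w.W_mul_W, hO]

variable (σ)

/-- The C⋆-algebra of bounded families indexed by all Weyl systems over `(V, σ)`. -/
abbrev WeylSum : Type (u + 1) := lp (fun w : WeylSystem σ => w.carrier) ∞

instance : CStarAlgebra (WeylSum σ) where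

/-- The universal Weyl family: its `w`-th component is `w.W x`. -/
def WeylSum.W (x : V) : WeylSum σ :=
  ⟨fun w => w.W x, memℓp_infty ⟨1, by rintro _ ⟨w, rfl⟩; exact w.norm_W_le x⟩⟩

/-- The CCR algebra `CCR(V, σ)`, the universal C⋆-algebra generated by a Weyl family over `(V, σ)`:
the closed unital ⋆-subalgebra generated by the direct sum of all Weyl systems over `(V, σ)`. -/
abbrev CCR : StarSubalgebra ℂ (WeylSum σ) :=
  (StarAlgebra.adjoin ℂ (Set.range (WeylSum.W σ))).topologicalClosure

instance : CStarAlgebra (CCR σ) :=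
  StarSubalgebra.cstarAlgebra (h_closed := StarSubalgebra.isClosed_topologicalClosure _)

/-- The generators of the CCR algebra. -/
def CCR.W (x : V) : CCR σ :=
  ⟨WeylSum.W σ x, StarSubalgebra.le_topologicalClosure _ (StarAlgebra.subset_adjoin ℂ _ ⟨x, rfl⟩)⟩

theorem CCR.W_zero : CCR.W σ 0 = 1 :=
  Subtype.ext (Subtype.ext (funext fun w => w.W_zero))

theorem CCR.star_W (x : V) : star (CCR.W σ x) = CCR.W σ (-x) :=
  Subtype.ext (Subtype.ext (funext fun w => w.star_W x))

theorem CCR.W_mul_W (x y : V) : CCR.W σ x * CCR.W σ y =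
    Complex.exp (Complex.I * (σ x y : ℂ)) • CCR.W σ (x + y) :=
  Subtype.ext (Subtype.ext (funext fun w => w.W_mul_W x y))

/-- The ⋆-homomorphism out of the CCR algebra induced by a Weyl system. -/
def CCR.lift (w : WeylSystem σ) : CCR σ →⋆ₐ[ℂ] w.carrier where
  toFun a := (a : WeylSum σ) w
  map_one' := rfl
  map_mul' _ _ := rfl
  map_zero' := rfl
  map_add' _ _ := rfl
  commutes' _ := rfl
  map_star' _ := rfl

theorem CCR.lift_W (w : WeylSystem σ) (x : V) : CCR.lift σ w (CCR.W σ x) = w.W x := rfl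

variable {σ}

/-- The substitution of Weyl systems `w ↦ w ∘ O`, on bounded families. -/
def WeylSum.map (O : V →ₗ[ℝ] V) (hO : ∀ x y, σ (O x) (O y) = σ x y) :
    WeylSum σ →⋆ₐ[ℂ] WeylSum σ where
  toFun a := ⟨fun w => a (w.precomp O hO), memℓp_infty ⟨‖a‖, by
    rintro _ ⟨w, rfl⟩; exact lp.norm_apply_le_norm ENNReal.top_ne_zero a (w.precomp O hO)⟩⟩
  map_one' := rfl
  map_mul' _ _ := rfl
  map_zero' := rfl
  map_add' _ _ := rfl
  commutes' _ := rfl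
  map_star' _ := rfl

theorem WeylSum.map_mem (O : V →ₗ[ℝ] V) (hO : ∀ x y, σ (O x) (O y) = σ x y) {a : WeylSum σ}
    (ha : a ∈ CCR σ) : WeylSum.map O hO a ∈ CCR σ := by
  have hc : Continuous (WeylSum.map O hO) := AddMonoidHomClass.continuous_of_bound _ 1 fun a => by
    simpa using NonUnitalStarAlgHom.norm_apply_le (WeylSum.map O hO) a
  have : CCR σ ≤ (CCR σ).comap (WeylSum.map O hO) := by
    refine StarSubalgebra.topologicalClosure_minimal ?_
      ((StarSubalgebra.isClosed_topologicalClosure _).preimage hc)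
    refine StarAlgebra.adjoin_le ?_
    rintro _ ⟨x, rfl⟩
    exact (CCR.W σ (O x)).2
  exact this ha

/-- The ⋆-endomorphism `ρ_O` of the CCR algebra with `ρ_O (W x) = W (O x)`. -/
def CCR.map (O : V →ₗ[ℝ] V) (hO : ∀ x y, σ (O x) (O y) = σ x y) : CCR σ →⋆ₐ[ℂ] CCR σ :=
  ((WeylSum.map O hO).comp (CCR σ).subtype).codRestrict (CCR σ)
    fun a => WeylSum.map_mem O hO a.2

theorem CCR.map_W (O : V →ₗ[ℝ] V) (hO : ∀ x y, σ (O x) (O y) = σ x y) (x : V) :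
    CCR.map O hO (CCR.W σ x) = CCR.W σ (O x) := rfl

end CCR

/-! ### C⋆-dynamical systems, given by a group `G` and a homomorphism `α : G →* Aut A` -/

section Dynamics

variable {A : Type*} [CStarAlgebra A] {G : Type*} [Group G] (α : G →* (A ≃⋆ₐ[ℂ] A))

/-- Asymptotic abelianness along a given sequence in `G`. -/
def IsAsymptoticallyAbelianAlong (g : ℕ → G) : Prop :=
  ∀ a b : A, Tendsto (fun n => ‖α (g n) a * b - b * α (g n) a‖) atTop (𝓝 0)

/-- Asymptotic abelianness. -/
def IsAsymptoticallyAbelian : Prop := ∃ g : ℕ → G, IsAsymptoticallyAbelianAlong α g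

/-- The set of `G`-invariant states, in the dual with the weak-⋆ topology. -/
def invariantStates : Set (WeakDual ℂ A) :=
  {φ | φ 1 = 1 ∧ (∀ a, 0 ≤ φ (star a * a)) ∧ ∀ g a, φ (α g a) = φ a}

variable [PartialOrder A] [StarOrderedRing A]

/-- The operator on the GNS space that extends `a ↦ θ a`, for an automorphism `θ` preserving the
positive functional `f`. -/
def gnsImplementer (f : A →ₚ[ℂ] ℂ) (θ : A ≃⋆ₐ[ℂ] A) (h : ∀ a, f (θ a) = f a) :
    f.GNS →L[ℂ] f.GNS :=
  (LinearMap.mkContinuous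
    (f.toPreGNS.toLinearMap ∘ₗ (θ : A →ₗ[ℂ] A) ∘ₗ f.ofPreGNS.toLinearMap) 1 (fun x => by
      simp [PositiveLinearMap.preGNS_norm_def, ← map_star, ← map_mul, h])).completion

/-- The space of vectors of the GNS space that are fixed by all the implementing operators. -/
def gnsInvariantVectors (f : A →ₚ[ℂ] ℂ) (h : ∀ g a, f (α g a) = f a) : Submodule ℂ f.GNS :=
  ⨅ g : G, LinearMap.eqLocus (gnsImplementer f (α g) (h g)).toLinearMap LinearMap.id

instance (f : A →ₚ[ℂ] ℂ) (h : ∀ g a, f (α g a) = f a) :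
    (gnsInvariantVectors α f h).HasOrthogonalProjection := by
  have hc : IsClosed (gnsInvariantVectors α f h : Set f.GNS) := by
    rw [gnsInvariantVectors, Submodule.coe_iInf]
    exact isClosed_iInter fun g =>
      isClosed_eq (gnsImplementer f (α g) (h g)).continuous continuous_id
  have := hc.completeSpace_coe
  exact Submodule.HasOrthogonalProjection.ofCompleteSpace _

/-- `G`-abelianness: for every `G`-invariant state, the compressions of the GNS representation to
the invariant vectors form a commuting family. -/
def IsGAbelian : Prop :=
  ∀ (f : A →ₚ[ℂ] ℂ) (_ : f 1 = 1) (h : ∀ g a, f (α g a) = f a) (a b : A),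
    let E : f.GNS →L[ℂ] f.GNS := (gnsInvariantVectors α f h).starProjection
    Commute (E * f.gnsStarAlgHom a * E) (E * f.gnsStarAlgHom b * E)

end Dynamics

/-! ### Choquet simplices -/

section Choquet

variable {F : Type*} [AddCommGroup F] [Module ℝ F]

/-- The convex cone generated by `K × {1}`, so that the convex set `K` sits in a hyperplane
missing the origin. -/
def coneOver (K : Set F) : Set (F × ℝ) :=
  {p | ∃ t : ℝ, 0 ≤ t ∧ ∃ x ∈ K, p = (t • x, t)}

/-- The real vector space `P - P` generated by the cone `P` over `K`. -/
def coneDiff (K : Set F) : Set (F × ℝ) :=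
  {p | ∃ x ∈ coneOver K, ∃ y ∈ coneOver K, p = x - y}

/-- A Choquet simplex: a compact convex set `K` such that, with `P` the cone over `K`, the space
`P - P` is a lattice in the order given by `u ≤ v ↔ v - u ∈ P` (existence of joins suffices, since
`u ↦ -u` reverses the order). -/
def IsChoquetSimplex [TopologicalSpace F] (K : Set F) : Prop :=
  IsCompact K ∧ Convex ℝ K ∧
    ∀ u ∈ coneDiff K, ∀ v ∈ coneDiff K, ∃ w ∈ coneDiff K,
      w - u ∈ coneOver K ∧ w - v ∈ coneOver K ∧
      ∀ z ∈ coneDiff K, z - u ∈ coneOver K → z - v ∈ coneOver K → z - w ∈ coneOver K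

end Choquet

/-! ### The group of localized orthogonal transformations and its action -/

section Model

variable {H : Type u} [NormedAddCommGroup H] [InnerProductSpace ℂ H]

/-- The symplectic form `σ(x, y) = Im ⟨x, y⟩` for the inner product linear in the first variable
(Mathlib's `⟪·, ·⟫_ℂ` is linear in the second variable). -/
def symplecticForm (H : Type u) [NormedAddCommGroup H] [InnerProductSpace ℂ H] :
    LinearMap.BilinForm ℝ H :=
  LinearMap.mk₂ ℝ (fun x y => (⟪y, x⟫_ℂ).im)
    (fun x y z => by simp)
    (fun c x y => by simp [inner_smul_right_eq_smul])
    (fun x y z => by simp)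
    (fun c x y => by simp [inner_smul_left_eq_smul])

/-- The ⋆-endomorphism `ρ_U` of `CCR(H, σ)` with `ρ_U (W x) = W (U x)`, for `U` unitary. -/
def rhoFull (U : H ≃ₗᵢ[ℂ] H) : CCR (symplecticForm H) →⋆ₐ[ℂ] CCR (symplecticForm H) :=
  CCR.map (U.toLinearEquiv.toLinearMap.restrictScalars ℝ) fun x y => by simp [symplecticForm]

theorem rhoFull_one (a : CCR (symplecticForm H)) : rhoFull (1 : H ≃ₗᵢ[ℂ] H) a = a := rfl

theorem rhoFull_mul (U U' : H ≃ₗᵢ[ℂ] H) (a : CCR (symplecticForm H)) :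
    rhoFull (U * U') a = rhoFull U (rhoFull U' a) := rfl

variable (e : HilbertBasis ℤ ℂ H)

/-- The dense subspace `H₀` of vectors with finitely many nonzero Fourier coefficients. -/
def finSpan : Submodule ℂ H := Submodule.span ℂ (Set.range e)

/-- The C⋆-subalgebra `B₀` of `CCR(H, σ)` generated by the `W x` with `x ∈ H₀`. -/
def B0 : StarSubalgebra ℂ (CCR (symplecticForm H)) :=
  (StarAlgebra.adjoin ℂ (CCR.W (symplecticForm H) '' (finSpan e : Set H))).topologicalClosure

instance : CStarAlgebra (B0 e) :=
  StarSubalgebra.cstarAlgebra (h_closed := StarSubalgebra.isClosed_topologicalClosure _)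

instance : PartialOrder (B0 e) := CStarAlgebra.spectralOrder _

instance : StarOrderedRing (B0 e) := CStarAlgebra.spectralOrderedRing _

/-- The group of localized orthogonal transformations: the unitaries that fix all but finitely many
of the basis vectors and have real matrix entries. -/
def orthogonalZ : Subgroup (H ≃ₗᵢ[ℂ] H) where
  carrier := {U | (∃ N : ℕ, ∀ i : ℤ, N < |i| → U (e i) = e i) ∧ ∀ i j, (⟪e j, U (e i)⟫_ℂ).im = 0}
  one_mem' := by
    refine ⟨⟨0, fun _ _ => rfl⟩, fun i j => ?_⟩
    have := orthonormal_iff_ite.mp e.orthonormal j i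
    simp only [LinearIsometryEquiv.coe_one, id, this]
    split_ifs <;> simp
  mul_mem' := by
    rintro U U' ⟨⟨N, hN⟩, hU⟩ ⟨⟨N', hN'⟩, hU'⟩
    refine ⟨⟨max N N', fun i hi => ?_⟩, fun i j => ?_⟩
    · push_cast at hi
      rw [LinearIsometryEquiv.coe_mul, Function.comp_apply, hN' i (lt_of_le_of_lt (le_max_right _ _) hi),
        hN i (lt_of_le_of_lt (le_max_left _ _) hi)]
    · have key : ⟪e j, (U * U') (e i)⟫_ℂ = ⟪U.symm (e j), U' (e i)⟫_ℂ := by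
        rw [← U.inner_map_map (U.symm (e j)), U.apply_symm_apply]; rfl
      rw [key]
      have h := (e.hasSum_inner_mul_inner (U.symm (e j)) (U' (e i))).mapL Complex.imCLM
      refine h.unique ?_ |>.trans rfl
      convert hasSum_zero using 2 with k
      have h1 : ⟪U.symm (e j), e k⟫_ℂ = ⟪e j, U (e k)⟫_ℂ := by
        rw [← U.inner_map_map (U.symm (e j)), U.apply_symm_apply]
      simp [h1, Complex.mul_im, hU, hU']
  inv_mem' := by
    rintro U ⟨⟨N, hN⟩, hU⟩
    refine ⟨⟨N, fun i hi => ?_⟩, fun i j => ?_⟩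
    · conv_lhs => rw [← hN i hi]
      exact U.symm_apply_apply _
    · have h1 : ⟪e j, U⁻¹ (e i)⟫_ℂ = ⟪U (e j), e i⟫_ℂ := by
        rw [← U.inner_map_map (e j)]
        congr 1
        exact U.apply_symm_apply _
      rw [h1, ← inner_conj_symm, Complex.conj_im, hU, neg_zero]

variable {e}

theorem orthogonalZ_map_finSpan {U : H ≃ₗᵢ[ℂ] H} (hU : U ∈ orthogonalZ e) {x : H}
    (hx : x ∈ finSpan e) : U x ∈ finSpan e := by
  obtain ⟨⟨N, hN⟩, -⟩ := hU
  have : finSpan e ≤ (finSpan e).comap U.toLinearEquiv.toLinearMap := by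
    refine Submodule.span_le.mpr ?_
    rintro _ ⟨i, rfl⟩
    change U (e i) ∈ finSpan e
    by_cases hi : (N : ℤ) < |i|
    · rw [hN i hi]; exact Submodule.subset_span ⟨i, rfl⟩
    · have hs := e.hasSum_repr (U (e i))
      have h0 : ∀ j ∉ Finset.Icc (-(N : ℤ)) N, e.repr (U (e i)) j • e j = 0 := by
        intro j hj
        have hj' : (N : ℤ) < |j| := by
          rw [Finset.mem_Icc, ← abs_le] at hj; exact not_le.mp hj
        have hij : j ≠ i := by rintro rfl; exact hi hj'
        rw [e.repr_apply_apply, ← hN j hj', U.inner_map_map,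
          orthonormal_iff_ite.mp e.orthonormal j i, if_neg hij, zero_smul]
      rw [hs.unique (hasSum_sum_of_ne_finset_zero h0)]
      exact Submodule.sum_mem _ fun j _ => Submodule.smul_mem _ _ (Submodule.subset_span ⟨j, rfl⟩)
  exact this hx

theorem rhoFull_mem {U : H ≃ₗᵢ[ℂ] H} (hU : U ∈ orthogonalZ e) {a : CCR (symplecticForm H)}
    (ha : a ∈ B0 e) : rhoFull U a ∈ B0 e := by
  have hc : Continuous (rhoFull U) := AddMonoidHomClass.continuous_of_bound _ 1 fun a => by
    simpa using NonUnitalStarAlgHom.norm_apply_le (rhoFull U) a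
  have : B0 e ≤ (B0 e).comap (rhoFull U) := by
    refine StarSubalgebra.topologicalClosure_minimal ?_
      ((StarSubalgebra.isClosed_topologicalClosure _).preimage hc)
    refine StarAlgebra.adjoin_le ?_
    rintro _ ⟨x, hx, rfl⟩
    exact StarSubalgebra.le_topologicalClosure _
      (StarAlgebra.subset_adjoin ℂ _ ⟨U x, orthogonalZ_map_finSpan hU hx, rfl⟩)
  exact this ha

variable (e)

/-- The restriction of `ρ_U` to `B₀`. -/
def rhoHom (U : orthogonalZ e) : B0 e →⋆ₐ[ℂ] B0 e :=
  ((rhoFull (U : H ≃ₗᵢ[ℂ] H)).comp (B0 e).subtype).codRestrict (B0 e) fun a => rhoFull_mem U.2 a.2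

theorem rhoHom_mul (U U' : orthogonalZ e) :
    rhoHom e (U * U') = (rhoHom e U).comp (rhoHom e U') := rfl

theorem rhoHom_one : rhoHom e 1 = StarAlgHom.id ℂ (B0 e) := rfl

/-- The action `ρ` of the group of localized orthogonal transformations on `B₀`. -/
def rho : orthogonalZ e →* (B0 e ≃⋆ₐ[ℂ] B0 e) where
  toFun U := StarAlgEquiv.ofStarAlgHom (rhoHom e U) (rhoHom e U⁻¹)
    (by rw [← rhoHom_mul, inv_mul_cancel, rhoHom_one])
    (by rw [← rhoHom_mul, mul_inv_cancel, rhoHom_one])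
  map_one' := rfl
  map_mul' _ _ := rfl

/-! ### The sequence of finite permutations -/

/-- The `n`-th map swaps `[0, 2 ^ n)` with `[2 ^ n, 2 ^ (n + 1))` and
`[-2 ^ n, 0)` with `[-2 ^ (n + 1), -2 ^ n)`, by translations. -/
def swapFun (n : ℕ) (k : ℤ) : ℤ :=
  if 0 ≤ k ∧ k < 2 ^ n then k + 2 ^ n
  else if 2 ^ n ≤ k ∧ k < 2 ^ (n + 1) then k - 2 ^ n
  else if -2 ^ n ≤ k ∧ k ≤ -1 then k - 2 ^ n
  else if -2 ^ (n + 1) ≤ k ∧ k < -2 ^ n then k + 2 ^ n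
  else k

theorem swapFun_swapFun (n : ℕ) (k : ℤ) : swapFun n (swapFun n k) = k := by
  have h : (0 : ℤ) < 2 ^ n := by positivity
  unfold swapFun
  rw [pow_succ]
  generalize (2 : ℤ) ^ n = m at *
  grind

theorem swapFun_eq_self (n : ℕ) (k : ℤ) (hk : 2 ^ (n + 1) < |k|) : swapFun n k = k := by
  have h : (0 : ℤ) < 2 ^ n := by positivity
  unfold swapFun
  rw [pow_succ] at *
  generalize (2 : ℤ) ^ n = m at *
  grind

/-- `swapFun n` as a permutation of `ℤ`. -/
def swapPerm (n : ℕ) : Equiv.Perm ℤ :=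
  ⟨swapFun n, swapFun n, swapFun_swapFun n, swapFun_swapFun n⟩

/-- The basis `i ↦ e (s i)`. -/
def permBasis [CompleteSpace H] (s : Equiv.Perm ℤ) : HilbertBasis ℤ ℂ H :=
  HilbertBasis.mk (v := fun i => e (s i)) (e.orthonormal.comp s s.injective) (by
    have : Set.range (fun i => e (s i)) = Set.range e := s.surjective.range_comp e
    rw [this, e.dense_span])

/-- The unitary operator of `H` with `e i ↦ e (s i)`. -/
def permUnitary [CompleteSpace H] (s : Equiv.Perm ℤ) : H ≃ₗᵢ[ℂ] H :=
  e.repr.trans (permBasis e s).repr.symm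

theorem permUnitary_apply [CompleteSpace H] (s : Equiv.Perm ℤ) (i : ℤ) :
    permUnitary e s (e i) = e (s i) := by
  simp [permUnitary, permBasis, HilbertBasis.repr_self, HilbertBasis.repr_symm_single]

theorem permUnitary_mem [CompleteSpace H] (s : Equiv.Perm ℤ) (N : ℕ)
    (hs : ∀ i : ℤ, N < |i| → s i = i) : permUnitary e s ∈ orthogonalZ e := by
  refine ⟨⟨N, fun i hi => by rw [permUnitary_apply, hs i hi]⟩, fun i j => ?_⟩
  rw [permUnitary_apply, orthonormal_iff_ite.mp e.orthonormal]
  split_ifs <;> simp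

/-- The permutations `swapPerm n`, as elements of the group of localized orthogonal
transformations. -/
def swapUnitary [CompleteSpace H] (n : ℕ) : orthogonalZ e :=
  ⟨permUnitary e (swapPerm n), permUnitary_mem e _ (2 ^ (n + 1)) fun i hi =>
    swapFun_eq_self n i (by exact_mod_cast hi)⟩

end Model

end

/-! The permutations push every finite block of basis vectors off itself, so for x, y in H₀ the
vector g_n x is orthogonal to y once n is large. Then σ vanishes on the pair and the Weyl elements
commute exactly. This passes to the ⋆-algebra they generate and, the action being contractive, to
its closure B₀ in norm. Everything else holds for any C⋆-system that is asymptotically abelian along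
a sequence.

Let E project the GNS space onto the invariant vectors. By the mean ergodic theorem, E π(b) η, for η
invariant, is a limit of vectors π(c) η with c in the convex hull of the orbit of b. Translating c
far along the sequence makes it almost commute with a and spoils nothing, so π(a) E π(b) and π(b) E
π(a) agree between invariant vectors (`inner_starProjection_comm`).

For the simplex, the commuting compressions E π(a) E and the cyclic invariant GNS vector force
self-adjoint operators in the commutant of the covariant representation to commute
(`MemCovariantCommutant.commute`). A Radon–Nikodym argument identifies these operators, order
included, with the invariant functionals bounded by multiples of an invariant positive F
(`exists_sup_boundedBy`). Commuting S, T have the supremum (S + T + |S - T|)/2, and the suprema for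
varying F agree (`exists_sup_coneDiff`). Compactness is Banach–Alaoglu. -/

noncomputable section

universe u

/-! ### Mean ergodic theorem in a Hilbert space -/

section MeanErgodic

variable {K : Type*} [NormedAddCommGroup K] [InnerProductSpace ℂ K]

/-- Alaoglu–Birkhoff: a convex set that is invariant under a family of isometries and lies in one
fibre of the projection onto the fixed vectors has that projection in its closure. -/
theorem starProjection_mem_closure_of_convex [CompleteSpace K] {ι : Type*} (U : ι → K →L[ℂ] K)
    (hU : ∀ i x y, ⟪U i x, U i y⟫_ℂ = ⟪x, y⟫_ℂ) (F : Submodule ℂ K) [F.HasOrthogonalProjection]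
    (hF : ∀ x, x ∈ F ↔ ∀ i, U i x = x) {D : Set K} (hD : Convex ℝ D)
    (hUD : ∀ i, ∀ y ∈ D, U i y ∈ D) {x : K} (hx : x ∈ D)
    (hE : ∀ y ∈ D, F.starProjection y = F.starProjection x) :
    F.starProjection x ∈ closure D := by
  let _ : InnerProductSpace ℝ K := InnerProductSpace.rclikeToReal ℂ K
  -- The point of `closure D` nearest to 0 is the candidate for the projection.
  obtain ⟨v, hv, hmin⟩ := exists_norm_eq_iInf_of_complete_convex (K := closure D)
    ⟨x, subset_closure hx⟩ isClosed_closure.isComplete hD.closure 0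
  rw [norm_eq_iInf_iff_real_inner_le_zero hD.closure hv] at hmin
  have hnorm : ∀ i y, ‖U i y‖ = ‖y‖ := fun i y => by
    rw [@norm_eq_sqrt_re_inner ℂ, hU, ← @norm_eq_sqrt_re_inner ℂ]
  have hfix : v ∈ F := by
    rw [hF]
    intro i
    have hm : U i v ∈ closure D :=
      map_mem_closure (U i).continuous hv (hUD i)
    -- The variational inequality gives ‖v‖² ≤ Re ⟪v, U i v⟫; as both vectors have the same norm,
    -- they coincide.
    have h1 := hmin _ hm
    rw [zero_sub, inner_neg_left, inner_sub_right, real_inner_self_eq_norm_sq] at h1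
    have h2 : ‖v - U i v‖ ^ 2 ≤ 0 := by
      rw [@norm_sub_sq_real, hnorm]; linarith
    have h3 : ‖v - U i v‖ = 0 := by
      have := sq_nonneg ‖v - U i v‖
      exact pow_eq_zero_iff two_ne_zero |>.mp (le_antisymm h2 this)
    exact (sub_eq_zero.mp (norm_eq_zero.mp h3)).symm
  have hEv : F.starProjection v = F.starProjection x := by
    have : closure D ⊆ {y | F.starProjection y = F.starProjection x} :=
      closure_minimal hE (isClosed_eq F.starProjection.continuous continuous_const)
    exact this hv
  rw [← hEv, Submodule.starProjection_eq_self_iff.mpr hfix]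
  exact hv

theorem starProjection_isometry_apply {ι : Type*} (U : ι → K →L[ℂ] K)
    (hU : ∀ i x y, ⟪U i x, U i y⟫_ℂ = ⟪x, y⟫_ℂ) (F : Submodule ℂ K) [F.HasOrthogonalProjection]
    (hF : ∀ x ∈ F, ∀ i, U i x = x) (i : ι) (x : K) :
    F.starProjection (U i x) = F.starProjection x := by
  rw [← sub_eq_zero, ← map_sub, Submodule.starProjection_apply_eq_zero_iff,
    Submodule.mem_orthogonal]
  intro ξ hξ
  rw [inner_sub_right, sub_eq_zero, ← hU i ξ x, hF ξ hξ i]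

end MeanErgodic

/-! ### GNS representation and its implementing isometries -/

section GNS

variable {A : Type*} [CStarAlgebra A] [PartialOrder A] [StarOrderedRing A] (f : A →ₚ[ℂ] ℂ)

/-- The vector of the GNS space given by an element of the algebra. -/
def gnsVec : A →ₗ[ℂ] f.GNS :=
  UniformSpace.Completion.toComplL.toLinearMap ∘ₗ f.toPreGNS.toLinearMap

theorem gnsVec_apply (a : A) : gnsVec f a = ((f.toPreGNS a : f.PreGNS) : f.GNS) := rfl

theorem denseRange_gnsVec : DenseRange (gnsVec f) := by
  have h : DenseRange ((↑) : f.PreGNS → f.GNS) := UniformSpace.Completion.denseRange_coe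
  exact h.comp f.toPreGNS.surjective.denseRange (UniformSpace.Completion.continuous_coe _)

theorem inner_gnsVec (a b : A) : ⟪gnsVec f a, gnsVec f b⟫_ℂ = f (star a * b) := by
  rw [gnsVec_apply, gnsVec_apply, UniformSpace.Completion.inner_coe, f.preGNS_inner_def]
  rfl

theorem gnsStarAlgHom_gnsVec (a b : A) : f.gnsStarAlgHom a (gnsVec f b) = gnsVec f (a * b) := by
  exact f.gnsNonUnitalStarAlgHom_apply_coe (a := a) (b := f.toPreGNS b)

theorem gnsVec_eq (a : A) : gnsVec f a = f.gnsStarAlgHom a (gnsVec f 1) := by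
  rw [gnsStarAlgHom_gnsVec, mul_one]

theorem inner_gnsStarAlgHom_left (a : A) (x y : f.GNS) :
    ⟪f.gnsStarAlgHom a x, y⟫_ℂ = ⟪x, f.gnsStarAlgHom (star a) y⟫_ℂ := by
  rw [map_star, ContinuousLinearMap.star_eq_adjoint, ContinuousLinearMap.adjoint_inner_right]

theorem inner_gnsStarAlgHom_right (a : A) (x y : f.GNS) :
    ⟪x, f.gnsStarAlgHom a y⟫_ℂ = ⟪f.gnsStarAlgHom (star a) x, y⟫_ℂ := by
  rw [inner_gnsStarAlgHom_left, star_star]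

theorem norm_gnsStarAlgHom_apply_le (a : A) (x : f.GNS) : ‖f.gnsStarAlgHom a x‖ ≤ ‖a‖ * ‖x‖ :=
  (ContinuousLinearMap.le_opNorm _ _).trans <| by
    gcongr; exact NonUnitalStarAlgHom.norm_apply_le f.gnsStarAlgHom a

theorem continuous_gnsVec : Continuous (gnsVec f) := by
  refine AddMonoidHomClass.continuous_of_bound (gnsVec f) ‖gnsVec f 1‖ fun a => ?_
  rw [gnsVec_eq, mul_comm]
  exact norm_gnsStarAlgHom_apply_le f a _

variable {f} in
theorem gns_clm_ext {E : Type*} [NormedAddCommGroup E] [NormedSpace ℂ E] {S T : f.GNS →L[ℂ] E}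
    (h : ∀ a, S (gnsVec f a) = T (gnsVec f a)) : S = T :=
  ContinuousLinearMap.coeFn_injective
    ((denseRange_gnsVec f).equalizer S.continuous T.continuous (funext h))

variable {f} in
theorem gns_clm_ext_inner {S T : f.GNS →L[ℂ] f.GNS}
    (h : ∀ a b, ⟪gnsVec f a, S (gnsVec f b)⟫_ℂ = ⟪gnsVec f a, T (gnsVec f b)⟫_ℂ) : S = T :=
  gns_clm_ext fun b => (denseRange_gnsVec f).eq_of_inner_right ℂ fun a => h a b

variable (θ : A ≃⋆ₐ[ℂ] A) (h : ∀ a, f (θ a) = f a)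

theorem gnsImplementer_gnsVec (a : A) : gnsImplementer f θ h (gnsVec f a) = gnsVec f (θ a) := by
  rw [gnsVec_apply, gnsImplementer, ContinuousLinearMap.completion_apply_coe]
  rfl

theorem inner_gnsImplementer (x y : f.GNS) :
    ⟪gnsImplementer f θ h x, gnsImplementer f θ h y⟫_ℂ = ⟪x, y⟫_ℂ := by
  refine (denseRange_gnsVec f).induction_on₂
    (p := fun x y => ⟪gnsImplementer f θ h x, gnsImplementer f θ h y⟫_ℂ = ⟪x, y⟫_ℂ) ?_ ?_ x y
  · apply isClosed_eq <;> fun_prop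
  · intro a b
    rw [gnsImplementer_gnsVec, gnsImplementer_gnsVec, inner_gnsVec, inner_gnsVec, ← map_star,
      ← map_mul, h]

theorem gnsImplementer_gnsStarAlgHom (a : A) (x : f.GNS) :
    gnsImplementer f θ h (f.gnsStarAlgHom a x) =
      f.gnsStarAlgHom (θ a) (gnsImplementer f θ h x) := by
  refine DFunLike.congr_fun (gns_clm_ext (S := gnsImplementer f θ h ∘L f.gnsStarAlgHom a)
    (T := f.gnsStarAlgHom (θ a) ∘L gnsImplementer f θ h) fun b => ?_) x
  simp only [ContinuousLinearMap.comp_apply, gnsStarAlgHom_gnsVec, gnsImplementer_gnsVec, map_mul]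

end GNS

/-! ### Asymptotic abelianness implies G-abelianness -/

section AsymptoticallyAbelian

variable {A : Type*} [CStarAlgebra A] {G : Type*} [Group G] {α : G →* (A ≃⋆ₐ[ℂ] A)}

variable (α) in
/-- The convex hull of the orbit of `b`. -/
def orbitHull (b : A) : Set A := convexHull ℝ (Set.range fun g => α g b)

theorem mem_orbitHull_self (b : A) : b ∈ orbitHull α b :=
  subset_convexHull _ _ ⟨1, by simp⟩

theorem apply_mem_orbitHull (g : G) {b c : A} (hc : c ∈ orbitHull α b) :
    α g c ∈ orbitHull α b := by
  have hconv : Convex ℝ ((fun c => α g c) ⁻¹' orbitHull α b) :=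
    (convex_convexHull ℝ _).linear_preimage ((α g : A →ₗ[ℂ] A).restrictScalars ℝ)
  refine convexHull_min ?_ hconv hc
  rintro _ ⟨k, rfl⟩
  exact subset_convexHull _ _ ⟨g * k, by simp⟩

theorem star_mem_orbitHull {b c : A} (hc : c ∈ orbitHull α b) :
    star c ∈ orbitHull α (star b) := by
  have hconv : Convex ℝ ((fun c => star c) ⁻¹' orbitHull α (star b)) :=
    (convex_convexHull ℝ _).linear_preimage
      ((starLinearEquiv ℝ (A := A) : A ≃ₗ⋆[ℝ] A).toLinearMap : A →ₗ[ℝ] A)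
  refine convexHull_min ?_ hconv hc
  rintro _ ⟨k, rfl⟩
  exact subset_convexHull _ _ ⟨k, by simp [map_star]⟩

variable [PartialOrder A] [StarOrderedRing A] {f : A →ₚ[ℂ] ℂ} (h : ∀ g a, f (α g a) = f a)

theorem mem_gnsInvariantVectors {x : f.GNS} :
    x ∈ gnsInvariantVectors α f h ↔ ∀ g, gnsImplementer f (α g) (h g) x = x := by
  simp [gnsInvariantVectors, Submodule.mem_iInf]

theorem gnsVec_one_mem : gnsVec f 1 ∈ gnsInvariantVectors α f h := by
  rw [mem_gnsInvariantVectors]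
  intro g
  rw [gnsImplementer_gnsVec, map_one]

variable {h}

/-- Balls are convex, and the implementer of g carries π(b)η - ζ to π(α g b)η - ζ because η and ζ
are invariant. Hence an approximation already achieved survives further averaging. -/
theorem norm_sub_le_of_mem_orbitHull {η ζ : f.GNS} (hη : η ∈ gnsInvariantVectors α f h)
    (hζ : ζ ∈ gnsInvariantVectors α f h) {b c : A} (hc : c ∈ orbitHull α b) {r : ℝ}
    (hb : ‖f.gnsStarAlgHom b η - ζ‖ < r) : ‖f.gnsStarAlgHom c η - ζ‖ < r := by
  have hconv : Convex ℝ ((fun c => f.gnsStarAlgHom c η) ⁻¹' Metric.ball ζ r) :=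
    (convex_ball ζ r).linear_preimage
      (((ContinuousLinearMap.apply ℂ f.GNS η).toLinearMap ∘ₗ
        f.gnsStarAlgHom.toAlgHom.toLinearMap).restrictScalars ℝ)
  have := convexHull_min ?_ hconv hc
  · simpa [dist_eq_norm] using this
  · rintro _ ⟨g, rfl⟩
    rw [Set.mem_preimage, mem_ball_iff_norm]
    refine lt_of_eq_of_lt ?_ hb
    have h1 : f.gnsStarAlgHom (α g b) η - ζ =
        gnsImplementer f (α g) (h g) (f.gnsStarAlgHom b η - ζ) := by
      rw [map_sub, gnsImplementer_gnsStarAlgHom, (mem_gnsInvariantVectors h).mp hη,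
        (mem_gnsInvariantVectors h).mp hζ]
    rw [h1, @norm_eq_sqrt_re_inner ℂ, inner_gnsImplementer, ← @norm_eq_sqrt_re_inner ℂ]

theorem starProjection_of_mem_orbitHull {η : f.GNS} (hη : η ∈ gnsInvariantVectors α f h)
    {b c : A} (hc : c ∈ orbitHull α b) :
    (gnsInvariantVectors α f h).starProjection (f.gnsStarAlgHom c η) =
      (gnsInvariantVectors α f h).starProjection (f.gnsStarAlgHom b η) := by
  set E := (gnsInvariantVectors α f h).starProjection
  have hconv : Convex ℝ ((fun c => E (f.gnsStarAlgHom c η)) ⁻¹' {E (f.gnsStarAlgHom b η)}) :=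
    (convex_singleton _).linear_preimage
      ((E.toLinearMap ∘ₗ (ContinuousLinearMap.apply ℂ f.GNS η).toLinearMap ∘ₗ
        f.gnsStarAlgHom.toAlgHom.toLinearMap).restrictScalars ℝ)
  refine convexHull_min ?_ hconv hc
  rintro _ ⟨g, rfl⟩
  have h1 := starProjection_isometry_apply (fun g => gnsImplementer f (α g) (h g))
    (fun g => inner_gnsImplementer f (α g) (h g)) (gnsInvariantVectors α f h)
    (fun x hx => (mem_gnsInvariantVectors h).mp hx) g (f.gnsStarAlgHom b η)
  rw [gnsImplementer_gnsStarAlgHom, (mem_gnsInvariantVectors h).mp hη] at h1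
  exact h1

theorem exists_mem_orbitHull_norm_lt {η : f.GNS} (hη : η ∈ gnsInvariantVectors α f h) (b : A)
    {ε : ℝ} (hε : 0 < ε) : ∃ c ∈ orbitHull α b, ‖f.gnsStarAlgHom c η -
      (gnsInvariantVectors α f h).starProjection (f.gnsStarAlgHom b η)‖ < ε := by
  have key := starProjection_mem_closure_of_convex (fun g => gnsImplementer f (α g) (h g))
    (fun g => inner_gnsImplementer f (α g) (h g)) (gnsInvariantVectors α f h)
    (fun x => mem_gnsInvariantVectors h) (D := (fun c => f.gnsStarAlgHom c η) '' orbitHull α b)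
    ((convex_convexHull ℝ _).linear_image
      (((ContinuousLinearMap.apply ℂ f.GNS η).toLinearMap ∘ₗ
        f.gnsStarAlgHom.toAlgHom.toLinearMap).restrictScalars ℝ)) ?_
    (x := f.gnsStarAlgHom b η) ⟨b, mem_orbitHull_self b, rfl⟩ ?_
  · obtain ⟨_, ⟨c, hc, rfl⟩, hd⟩ := Metric.mem_closure_iff.mp key ε hε
    exact ⟨c, hc, by rwa [← dist_eq_norm, dist_comm]⟩
  · rintro g _ ⟨c, hc, rfl⟩
    refine ⟨α g c, apply_mem_orbitHull g hc, ?_⟩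
    rw [gnsImplementer_gnsStarAlgHom, (mem_gnsInvariantVectors h).mp hη]
  · rintro _ ⟨c, hc, rfl⟩
    exact starProjection_of_mem_orbitHull hη hc

/-- Average b to suit η, then average the adjoint of the result to suit ξ, and finally translate
along the sequence until the commutator with a is small. Each stage stays in the orbit hull of the
previous one, so the earlier estimates persist. -/
theorem exists_approx_starProjection {g : ℕ → G} (hg : IsAsymptoticallyAbelianAlong α g)
    {ξ η : f.GNS} (hξ : ξ ∈ gnsInvariantVectors α f h) (hη : η ∈ gnsInvariantVectors α f h)
    (a b : A) {ε : ℝ} (hε : 0 < ε) : ∃ c : A,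
      ‖f.gnsStarAlgHom c η -
        (gnsInvariantVectors α f h).starProjection (f.gnsStarAlgHom b η)‖ < ε ∧
      ‖f.gnsStarAlgHom (star c) ξ -
        (gnsInvariantVectors α f h).starProjection (f.gnsStarAlgHom (star b) ξ)‖ < ε ∧
      ‖c * a - a * c‖ < ε := by
  obtain ⟨c, hc, hcη⟩ := exists_mem_orbitHull_norm_lt hη b hε
  obtain ⟨d, hd, hdξ⟩ := exists_mem_orbitHull_norm_lt hξ (star c) hε
  rw [starProjection_of_mem_orbitHull hξ (star_mem_orbitHull hc)] at hdξ
  have hd' : star d ∈ orbitHull α c := by simpa using star_mem_orbitHull hd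
  have hdη := norm_sub_le_of_mem_orbitHull hη (Submodule.starProjection_apply_mem _ _) hd' hcη
  obtain ⟨n, hn⟩ := ((hg (star d) a).eventually (gt_mem_nhds hε)).exists
  refine ⟨α (g n) (star d), ?_, ?_, hn⟩
  · exact norm_sub_le_of_mem_orbitHull hη (Submodule.starProjection_apply_mem _ _)
      (apply_mem_orbitHull (g n) (mem_orbitHull_self (star d))) hdη
  · rw [← map_star, star_star]
    exact norm_sub_le_of_mem_orbitHull hξ (Submodule.starProjection_apply_mem _ _)
      (apply_mem_orbitHull (g n) (mem_orbitHull_self d)) hdξ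

/-- With c n as in `exists_approx_starProjection`, ⟪ξ, a (c n) η⟫ tends to the left side, while ⟪ξ,
(c n) a η⟫ = ⟪(c n)⋆ ξ, a η⟫ tends to ⟪E b⋆ ξ, a η⟫, which is the right side. The commutators tend
to 0. -/
theorem inner_starProjection_comm {g : ℕ → G} (hg : IsAsymptoticallyAbelianAlong α g)
    {ξ η : f.GNS} (hξ : ξ ∈ gnsInvariantVectors α f h) (hη : η ∈ gnsInvariantVectors α f h)
    (a b : A) :
    ⟪ξ, f.gnsStarAlgHom a
      ((gnsInvariantVectors α f h).starProjection (f.gnsStarAlgHom b η))⟫_ℂ =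
    ⟪ξ, f.gnsStarAlgHom b
      ((gnsInvariantVectors α f h).starProjection (f.gnsStarAlgHom a η))⟫_ℂ := by
  set E := (gnsInvariantVectors α f h).starProjection
  choose c hcη hcξ hca using fun n : ℕ =>
    exists_approx_starProjection hg hξ hη a b (Nat.one_div_pos_of_nat (n := n) (α := ℝ))
  have hlim : ∀ {M : Type _} [SeminormedAddCommGroup M] {x : ℕ → M} {y : M},
      (∀ n : ℕ, ‖x n - y‖ < 1 / ((n : ℝ) + 1)) → Tendsto x atTop (𝓝 y) := fun hx =>
    tendsto_iff_norm_sub_tendsto_zero.mpr (squeeze_zero (fun _ => norm_nonneg _)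
      (fun n => (hx n).le) tendsto_one_div_add_atTop_nhds_zero_nat)
  have h1 := hlim hcη
  have h2 := hlim hcξ
  have h3 : Tendsto (fun n => c n * a - a * c n) atTop (𝓝 0) := hlim (by simpa using hca)
  have l1 : Tendsto (fun n => ⟪ξ, f.gnsStarAlgHom a (f.gnsStarAlgHom (c n) η)⟫_ℂ) atTop
      (𝓝 ⟪ξ, f.gnsStarAlgHom a (E (f.gnsStarAlgHom b η))⟫_ℂ) :=
    tendsto_const_nhds.inner (((f.gnsStarAlgHom a).continuous.tendsto _).comp h1)
  have l2 : Tendsto (fun n => ⟪f.gnsStarAlgHom (star (c n)) ξ, f.gnsStarAlgHom a η⟫_ℂ) atTop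
      (𝓝 ⟪E (f.gnsStarAlgHom (star b) ξ), f.gnsStarAlgHom a η⟫_ℂ) :=
    h2.inner tendsto_const_nhds
  have l3 : Tendsto (fun n => ⟪ξ, f.gnsStarAlgHom (c n * a - a * c n) η⟫_ℂ) atTop (𝓝 0) := by
    have : Tendsto (fun n => f.gnsStarAlgHom (c n * a - a * c n) η) atTop (𝓝 0) := by
      refine squeeze_zero_norm (fun n => norm_gnsStarAlgHom_apply_le f _ _) ?_
      simpa using h3.norm.mul_const ‖η‖
    simpa using (tendsto_const_nhds (x := ξ)).inner (𝕜 := ℂ) this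
  have l4 := (l2.sub l1).congr (f₂ := fun n => ⟪ξ, f.gnsStarAlgHom (c n * a - a * c n) η⟫_ℂ)
    fun n => by
      rw [inner_gnsStarAlgHom_left, star_star, map_sub, map_mul, map_mul, sub_apply,
        inner_sub_right]
      rfl
  have l5 := sub_eq_zero.mp (tendsto_nhds_unique l4 l3)
  rw [← l5, Submodule.inner_starProjection_left_eq_right, inner_gnsStarAlgHom_left, star_star]

variable (h) in
theorem commute_compressions {g : ℕ → G} (hg : IsAsymptoticallyAbelianAlong α g) (a b : A) :
    Commute ((gnsInvariantVectors α f h).starProjection * f.gnsStarAlgHom a *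
        (gnsInvariantVectors α f h).starProjection)
      ((gnsInvariantVectors α f h).starProjection * f.gnsStarAlgHom b *
        (gnsInvariantVectors α f h).starProjection) := by
  set E := (gnsInvariantVectors α f h).starProjection
  have hE : ∀ x, E (E x) = E x := fun x =>
    Submodule.starProjection_eq_self_iff.mpr (Submodule.starProjection_apply_mem _ _)
  refine ContinuousLinearMap.ext fun y => ext_inner_left ℂ fun x => ?_
  simp only [mul_apply_eq_comp, hE]
  rw [← Submodule.inner_starProjection_left_eq_right,
    ← Submodule.inner_starProjection_left_eq_right]
  exact inner_starProjection_comm hg (Submodule.starProjection_apply_mem _ _)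
    (Submodule.starProjection_apply_mem _ _) a b

theorem IsAsymptoticallyAbelianAlong.isGAbelian {g : ℕ → G}
    (hg : IsAsymptoticallyAbelianAlong α g) : IsGAbelian α :=
  fun _ _ h a b => commute_compressions h hg a b

end AsymptoticallyAbelian

/-! ### Suprema of commuting self-adjoint elements -/

section CStar

variable {B : Type*} [CStarAlgebra B] [PartialOrder B] [StarOrderedRing B]

/-- The product (X - D)(X + D) of commuting positive elements is positive, so D² ≤ X², and the
square root is operator monotone. -/
theorem CFC.abs_le_of_commute {D X : B} (hc : Commute X D) (h1 : 0 ≤ X - D) (h2 : 0 ≤ X + D) :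
    CFC.abs D ≤ X := by
  have hX2 : 0 ≤ (2 : ℝ) • X := by
    have : (2 : ℝ) • X = (X - D) + (X + D) := by rw [two_smul]; abel
    rw [this]; exact add_nonneg h1 h2
  have hX : 0 ≤ X := by
    have := smul_nonneg (show (0 : ℝ) ≤ 2⁻¹ by norm_num) hX2
    rwa [smul_smul, inv_mul_cancel₀ two_ne_zero, one_smul] at this
  have hD : IsSelfAdjoint D := by
    have := hX.isSelfAdjoint.sub h1.isSelfAdjoint
    rwa [sub_sub_cancel] at this
  have hcomm : Commute (X - D) (X + D) :=
    ((Commute.refl X).sub_left hc.symm).add_right (hc.sub_left (Commute.refl D))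
  have hprod : 0 ≤ X * X - D * D := by
    have := hcomm.mul_nonneg h1 h2
    rwa [sub_mul, mul_add, mul_add, hc.eq, add_comm (X * X), add_sub_add_left_eq_sub] at this
  have := CFC.sqrt_le_sqrt (D * D) (X * X) (sub_nonneg.mp hprod)
  rw [CFC.sqrt_mul_self X hX] at this
  rwa [CFC.abs, hD.star_eq]

theorem CFC.commute_abs_of_isSelfAdjoint {D b : B} (hD : IsSelfAdjoint D) (h : Commute D b) :
    Commute (CFC.abs D) b := by
  have h' : Commute D (star b) := by
    have := congrArg star h.eq
    rw [star_mul, star_mul, hD.star_eq] at this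
    exact this.symm
  exact (Commute.cfcAbs_right h h').symm

/-- The supremum of two self-adjoint elements, among those that commute with both. -/
def cfcSup (S T : B) : B := (2⁻¹ : ℝ) • (S + T + CFC.abs (S - T))

theorem sub_cfcSup_left (S T : B) (hS : IsSelfAdjoint S) (hT : IsSelfAdjoint T) :
    0 ≤ cfcSup S T - S := by
  have h : cfcSup S T - S = (2⁻¹ : ℝ) • (CFC.abs (S - T) - (S - T)) := by
    rw [cfcSup]; module
  rw [h, CFC.abs_sub_self (S - T) (hS.sub hT)]
  exact smul_nonneg (by norm_num) (nsmul_nonneg (CFC.negPart_nonneg _) _)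

theorem cfcSup_comm (S T : B) : cfcSup S T = cfcSup T S := by
  rw [cfcSup, cfcSup, ← CFC.abs_neg (S - T), neg_sub, add_comm S T]

theorem cfcSup_le {S T Z : B} (hS : Commute Z S) (hT : Commute Z T) (hST : Commute S T)
    (h1 : 0 ≤ Z - S) (h2 : 0 ≤ Z - T) : 0 ≤ Z - cfcSup S T := by
  -- Take X = (Z - S) + (Z - T) and D = S - T: then X - D = 2(Z - S) and X + D = 2(Z - T).
  have key : CFC.abs (S - T) ≤ (Z - S) + (Z - T) := by
    refine CFC.abs_le_of_commute ?_ ?_ ?_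
    · exact ((hS.sub_right hT).sub_left ((Commute.refl S).sub_right hST)).add_left
        ((hS.sub_right hT).sub_left (hST.symm.sub_right (Commute.refl T)))
    · have : Z - S + (Z - T) - (S - T) = (2 : ℝ) • (Z - S) := by module
      rw [this]; exact smul_nonneg (by norm_num) h1
    · have : Z - S + (Z - T) + (S - T) = (2 : ℝ) • (Z - T) := by module
      rw [this]; exact smul_nonneg (by norm_num) h2
  have : Z - cfcSup S T = (2⁻¹ : ℝ) • ((Z - S) + (Z - T) - CFC.abs (S - T)) := by
    rw [cfcSup]; module
  rw [this]
  exact smul_nonneg (by norm_num) (sub_nonneg.mpr key)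

theorem commute_cfcSup {S T b : B} (hS : IsSelfAdjoint S) (hT : IsSelfAdjoint T)
    (h1 : Commute S b) (h2 : Commute T b) : Commute (cfcSup S T) b :=
  ((h1.add_left h2).add_left
    (CFC.commute_abs_of_isSelfAdjoint (hS.sub hT) (h1.sub_left h2))).smul_left _

end CStar

/-! ### Operators commuting with an abelian self-adjoint family -/

section Hilbert

variable {K : Type*} [NormedAddCommGroup K] [InnerProductSpace ℂ K] [CompleteSpace K]

theorem IsSelfAdjoint.inner_apply {T : K →L[ℂ] K} (hT : IsSelfAdjoint T) (x y : K) :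
    ⟪T x, y⟫_ℂ = ⟪x, T y⟫_ℂ := by
  conv_lhs => rw [← hT.star_eq, ContinuousLinearMap.star_eq_adjoint,
    ContinuousLinearMap.adjoint_inner_left]

/-- Two self-adjoint operators in the commutant of an abelian family commute weakly on the orbit
of a vector, if one of them maps the vector into the closure of the orbit. -/
theorem inner_apply_comm_of_abelian {ι : Type*} {M : ι → K →L[ℂ] K}
    (hM : ∀ i j, Commute (M i) (M j)) (hstar : ∀ i, ∃ j, star (M i) = M j) {S T : K →L[ℂ] K}
    (hSa : IsSelfAdjoint S) (hS : ∀ i, Commute S (M i)) (hT : ∀ i, Commute T (M i)) {Ω : K}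
    (hΩ : S Ω ∈ closure (Set.range fun i => M i Ω)) (i : ι) :
    ⟪M i Ω, T (S Ω)⟫_ℂ = ⟪M i Ω, S (T Ω)⟫_ℂ := by
  obtain ⟨x, hx, hlim⟩ := mem_closure_iff_seq_limit.mp hΩ
  choose k hk using hx
  simp only at hk
  -- M (k n) - S is normal, so it and its adjoint give Ω the same norm: the adjoints approximate S Ω
  -- as well.
  have hlim' : Tendsto (fun n => star (M (k n)) Ω) atTop (𝓝 (S Ω)) := by
    rw [tendsto_iff_norm_sub_tendsto_zero] at hlim ⊢
    refine hlim.congr fun n => ?_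
    have hn : IsStarNormal (M (k n) - S) := by
      refine ⟨?_⟩
      obtain ⟨j, hj⟩ := hstar (k n)
      rw [star_sub, hSa.star_eq, hj]
      exact ((hM _ _).sub_right (hS _).symm).sub_left ((hS _).sub_right (Commute.refl S))
    have := ContinuousLinearMap.isStarNormal_iff_norm_eq_adjoint.mp hn Ω
    rw [← ContinuousLinearMap.star_eq_adjoint, star_sub, hSa.star_eq] at this
    rw [← hk n]
    exact this
  have l1 : Tendsto (fun n => ⟪M i Ω, T (x n)⟫_ℂ) atTop (𝓝 ⟪M i Ω, T (S Ω)⟫_ℂ) :=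
    tendsto_const_nhds.inner ((T.continuous.tendsto _).comp hlim)
  have l2 : Tendsto (fun n => ⟪M i (star (M (k n)) Ω), T Ω⟫_ℂ) atTop
      (𝓝 ⟪M i (S Ω), T Ω⟫_ℂ) :=
    (((M i).continuous.tendsto _).comp hlim').inner tendsto_const_nhds
  have h2 : ⟪M i (S Ω), T Ω⟫_ℂ = ⟪M i Ω, S (T Ω)⟫_ℂ := by
    rw [← hSa.inner_apply]
    exact congrArg (⟪·, T Ω⟫_ℂ) (DFunLike.congr_fun (hS i).eq Ω).symm
  rw [← h2]
  -- Both sequences are equal termwise: move M (k n) past T, across the inner product, and its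
  -- adjoint past M i.
  refine tendsto_nhds_unique l1 (l2.congr fun n => ?_)
  obtain ⟨j, hj⟩ := hstar (k n)
  have e1 : M i (star (M (k n)) Ω) = star (M (k n)) (M i Ω) := by
    rw [hj]; exact DFunLike.congr_fun (hM i j).eq Ω
  rw [e1, ContinuousLinearMap.star_eq_adjoint, ContinuousLinearMap.adjoint_inner_left, ← hk n]
  exact congrArg (⟪M i Ω, ·⟫_ℂ) (DFunLike.congr_fun (hT (k n)).eq Ω).symm

end Hilbert

/-! ### Commutant of the covariant representation -/

section Commutant

variable {A : Type*} [CStarAlgebra A] {G : Type*} [Group G] {α : G →* (A ≃⋆ₐ[ℂ] A)}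
  [PartialOrder A] [StarOrderedRing A] {f : A →ₚ[ℂ] ℂ} (h : ∀ g a, f (α g a) = f a)

/-- The operators on the GNS space that commute with the covariant representation. -/
structure MemCovariantCommutant (T : f.GNS →L[ℂ] f.GNS) : Prop where
  hom : ∀ a, Commute T (f.gnsStarAlgHom a)
  imp : ∀ g, Commute T (gnsImplementer f (α g) (h g))

variable {h}

theorem MemCovariantCommutant.apply_mem {T : f.GNS →L[ℂ] f.GNS}
    (hT : MemCovariantCommutant h T) {x : f.GNS} (hx : x ∈ gnsInvariantVectors α f h) :
    T x ∈ gnsInvariantVectors α f h := by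
  rw [mem_gnsInvariantVectors] at hx ⊢
  intro g
  conv_rhs => rw [← hx g]
  exact (DFunLike.congr_fun (hT.imp g).eq x).symm

/-- T preserves the range of E, so E T E = T E; for self-adjoint T the adjoint of this identity is E
T E = E T. -/
theorem MemCovariantCommutant.commute_starProjection {T : f.GNS →L[ℂ] f.GNS}
    (hT : MemCovariantCommutant h T) (hTa : IsSelfAdjoint T) :
    Commute T (gnsInvariantVectors α f h).starProjection := by
  set E := (gnsInvariantVectors α f h).starProjection
  have hEa : star E = E := (isSelfAdjoint_starProjection _).star_eq
  have h1 : E * (T * E) = T * E := ContinuousLinearMap.ext fun x =>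
    Submodule.starProjection_eq_self_iff.mpr
      (hT.apply_mem (Submodule.starProjection_apply_mem _ _))
  have h2 := congrArg star h1
  rw [star_mul, star_mul, hEa, hTa.star_eq, mul_assoc, h1] at h2
  exact h2

/-- The vector S Ω, with Ω the GNS vector, is invariant, hence a limit of vectors E π(a) Ω. So
`inner_apply_comm_of_abelian` applies to the compressions and yields T S Ω = S T Ω; since Ω is
cyclic, it separates the commutant. -/
theorem MemCovariantCommutant.commute
    (hc : ∀ a b, Commute ((gnsInvariantVectors α f h).starProjection * f.gnsStarAlgHom a *
        (gnsInvariantVectors α f h).starProjection)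
      ((gnsInvariantVectors α f h).starProjection * f.gnsStarAlgHom b *
        (gnsInvariantVectors α f h).starProjection))
    {S T : f.GNS →L[ℂ] f.GNS} (hS : MemCovariantCommutant h S) (hSa : IsSelfAdjoint S)
    (hT : MemCovariantCommutant h T) (hTa : IsSelfAdjoint T) : Commute S T := by
  set E := (gnsInvariantVectors α f h).starProjection with hEdef
  have hSE : Commute S E := hS.commute_starProjection hSa
  have hTE : Commute T E := hT.commute_starProjection hTa
  have hEa : star E = E := (isSelfAdjoint_starProjection _).star_eq
  have hEΩ : E (gnsVec f 1) = gnsVec f 1 :=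
    Submodule.starProjection_eq_self_iff.mpr (gnsVec_one_mem h)
  have hMΩ : ∀ a, (E * f.gnsStarAlgHom a * E) (gnsVec f 1) = E (gnsVec f a) := fun a => by
    rw [mul_apply_eq_comp, mul_apply_eq_comp, hEΩ, ← gnsVec_eq]
  have hfix : ∀ x ∈ gnsInvariantVectors α f h, E x = x := fun x hx =>
    Submodule.starProjection_eq_self_iff.mpr hx
  have key := inner_apply_comm_of_abelian (M := fun a => E * f.gnsStarAlgHom a * E) hc
    (fun a => ⟨star a, by rw [star_mul, star_mul, hEa, ← map_star, mul_assoc]⟩)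
    hSa (fun a => (hSE.mul_right (hS.hom a)).mul_right hSE)
    (fun a => (hTE.mul_right (hT.hom a)).mul_right hTE) (Ω := gnsVec f 1) (by
      simp only [hMΩ]
      rw [← hfix _ (hS.apply_mem (gnsVec_one_mem h))]
      have := map_mem_closure E.continuous ((denseRange_gnsVec f) (S (gnsVec f 1)))
        (t := Set.range fun a => E (gnsVec f a)) (by rintro _ ⟨a, rfl⟩; exact ⟨a, rfl⟩)
      exact this)
  have key2 : T (S (gnsVec f 1)) = S (T (gnsVec f 1)) := by
    refine (denseRange_gnsVec f).eq_of_inner_right ℂ fun a => ?_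
    have := key a
    rw [hMΩ, Submodule.inner_starProjection_left_eq_right,
      Submodule.inner_starProjection_left_eq_right, ← hEdef,
      hfix _ (hT.apply_mem (hS.apply_mem (gnsVec_one_mem h))),
      hfix _ (hS.apply_mem (hT.apply_mem (gnsVec_one_mem h)))] at this
    exact this
  refine gns_clm_ext fun a => ?_
  have e1 := DFunLike.congr_fun ((hS.hom a).mul_left (hT.hom a)).eq (gnsVec f 1)
  have e2 := DFunLike.congr_fun ((hT.hom a).mul_left (hS.hom a)).eq (gnsVec f 1)
  simp only [mul_apply_eq_comp] at e1 e2
  rw [gnsVec_eq, mul_apply_eq_comp, mul_apply_eq_comp, e1, e2, key2]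

end Commutant

/-! ### From local suprema to the lattice property of the cone -/

section OrderTheory

variable {F : Type*} [AddCommGroup F] [Module ℝ F]

/-- The elements of `F` bounded from both sides by multiples of `f`, in the order with positive
cone `P`. -/
def boundedBy (P : Set F) (f : F) : Set F :=
  {u | ∃ C : ℝ, 0 ≤ C ∧ u + C • f ∈ P ∧ C • f - u ∈ P}

/-- A convex set cut out of a cone `P` by a strictly positive functional satisfies the lattice
condition for Choquet simplices if suprema exist among the elements bounded by each `f ∈ P`. -/
theorem exists_sup_coneDiff {P K : Set F} {l : F →ₗ[ℝ] ℝ} (hadd : ∀ x ∈ P, ∀ y ∈ P, x + y ∈ P)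
    (hsmul : ∀ c : ℝ, 0 ≤ c → ∀ x ∈ P, c • x ∈ P) (hpos : ∀ x ∈ P, 0 ≤ l x)
    (hl : ∀ x ∈ P, l x = 0 → x = 0) (hK : ∀ x, x ∈ K ↔ x ∈ P ∧ l x = 1)
    (hsup : ∀ f ∈ P, ∀ u ∈ boundedBy P f, ∀ v ∈ boundedBy P f, ∃ w ∈ boundedBy P f,
      w - u ∈ P ∧ w - v ∈ P ∧ ∀ z ∈ boundedBy P f, z - u ∈ P → z - v ∈ P → z - w ∈ P) :
    ∀ u ∈ coneDiff K, ∀ v ∈ coneDiff K, ∃ w ∈ coneDiff K,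
      w - u ∈ coneOver K ∧ w - v ∈ coneOver K ∧
      ∀ z ∈ coneDiff K, z - u ∈ coneOver K → z - v ∈ coneOver K → z - w ∈ coneOver K := by
  have hcone : ∀ {p : F × ℝ}, p ∈ coneOver K → p.1 ∈ P ∧ p.2 = l p.1 := by
    rintro _ ⟨t, ht, x, hx, rfl⟩
    rw [hK] at hx
    exact ⟨hsmul t ht x hx.1, by simp [hx.2]⟩
  have hdiff : ∀ {p : F × ℝ}, p ∈ coneDiff K →
      ∃ x ∈ P, ∃ y ∈ P, p.1 = x - y ∧ p.2 = l p.1 := by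
    rintro _ ⟨x, hx, y, hy, rfl⟩
    exact ⟨x.1, (hcone hx).1, y.1, (hcone hy).1, rfl, by
      simp [(hcone hx).2, (hcone hy).2]⟩
  rintro u hu v hv
  obtain ⟨k, hk⟩ : K.Nonempty := by
    obtain ⟨_, ⟨_, _, k, hk, _⟩, _⟩ := hu
    exact ⟨k, hk⟩
  -- Normalise by l x; when l x = 0 the point is the apex, and writing it as 0 • k requires a point
  -- k of K.
  have hcone' : ∀ {p : F × ℝ}, p.1 ∈ P → p.2 = l p.1 → p ∈ coneOver K := by
    rintro ⟨x, t⟩ hx ht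
    simp only at hx ht
    subst ht
    rcases (hpos x hx).eq_or_lt with h0 | h0
    · refine ⟨0, le_rfl, k, hk, ?_⟩
      rw [← h0, hl x hx h0.symm, zero_smul]
    · refine ⟨l x, h0.le, (l x)⁻¹ • x, (hK _).mpr ⟨hsmul _ (inv_pos.mpr h0).le x hx, ?_⟩, ?_⟩
      · simp [h0.ne']
      · rw [smul_smul, mul_inv_cancel₀ h0.ne', one_smul]
  have hbdd : ∀ {f x : F}, x ∈ P → f - x ∈ P → x ∈ boundedBy P f := fun {f x} hx hfx =>
    ⟨1, zero_le_one, hadd _ hx _ (by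
      have := hadd _ hfx _ hx
      simpa using this), by simpa using hfx⟩
  have hbsub : ∀ {f x y : F}, f ∈ P → x ∈ P → y ∈ P → f - (x + y) ∈ P →
      x - y ∈ boundedBy P f := fun {f x y} hf hx hy hxy => by
    refine ⟨1, zero_le_one, ?_, ?_⟩
    · have : x - y + (1 : ℝ) • f = (f - (x + y)) + (x + x) := by module
      rw [this]; exact hadd _ hxy _ (hadd _ hx _ hx)
    · have : (1 : ℝ) • f - (x - y) = (f - (x + y)) + (y + y) := by module
      rw [this]; exact hadd _ hxy _ (hadd _ hy _ hy)
  obtain ⟨p₁, hp₁, p₂, hp₂, hup, hul⟩ := hdiff hu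
  obtain ⟨p₃, hp₃, p₄, hp₄, hvp, hvl⟩ := hdiff hv
  have h0 : (0 : F) ∈ P := by simpa using hsmul 0 le_rfl p₁ hp₁
  set f := p₁ + p₂ + (p₃ + p₄) with hf
  have hfP : f ∈ P := hadd _ (hadd _ hp₁ _ hp₂) _ (hadd _ hp₃ _ hp₄)
  have hub : u.1 ∈ boundedBy P f := hup ▸ hbsub hfP hp₁ hp₂ (by
    rw [hf, add_sub_cancel_left]; exact hadd _ hp₃ _ hp₄)
  have hvb : v.1 ∈ boundedBy P f := hvp ▸ hbsub hfP hp₃ hp₄ (by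
    rw [hf, add_sub_cancel_right]; exact hadd _ hp₁ _ hp₂)
  obtain ⟨w, ⟨C, hC, hwC, hwC'⟩, hwu, hwv, hw⟩ := hsup f hfP _ hub _ hvb
  have hmono : ∀ {f' y : F}, f' - f ∈ P → y ∈ boundedBy P f → y ∈ boundedBy P f' := by
    rintro f' y hff' ⟨D, hD, h1, h2⟩
    refine ⟨D, hD, ?_, ?_⟩
    · have : y + D • f' = (y + D • f) + D • (f' - f) := by module
      rw [this]; exact hadd _ h1 _ (hsmul D hD _ hff')
    · have : D • f' - y = (D • f - y) + D • (f' - f) := by module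
      rw [this]; exact hadd _ h2 _ (hsmul D hD _ hff')
  refine ⟨(w, l w), ?_, ?_, ?_, ?_⟩
  · refine ⟨((w - u.1) + p₁, l ((w - u.1) + p₁)), hcone' (hadd _ hwu _ hp₁) rfl, (p₂, l p₂),
      hcone' hp₂ rfl, ?_⟩
    rw [Prod.mk_sub_mk, ← map_sub, hup]
    congr 2 <;> abel_nf
  · exact hcone' hwu (by simp [hul])
  · exact hcone' hwv (by simp [hvl])
  rintro z hz hzu hzv
  obtain ⟨q₁, hq₁, q₂, hq₂, hzq, hzl⟩ := hdiff hz
  -- The competitor z need not be bounded by f, so the supremum w' is taken again relative to a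
  -- larger f' that also bounds z.
  set f' := f + (q₁ + q₂) with hf'
  have hff' : f' - f ∈ P := by rw [hf', add_sub_cancel_left]; exact hadd _ hq₁ _ hq₂
  have hfP' : f' ∈ P := hadd _ hfP _ (hadd _ hq₁ _ hq₂)
  have hzb : z.1 ∈ boundedBy P f' := hzq ▸ hbsub hfP' hq₁ hq₂ (by
    rw [hf', add_sub_cancel_right]; exact hfP)
  obtain ⟨w', -, hwu', hwv', hw'⟩ := hsup f' hfP' _ (hmono hff' hub) _ (hmono hff' hvb)
  have h1 : z.1 - w' ∈ P := hw' _ hzb (hcone hzu).1 (hcone hzv).1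
  have h2 : w - w' ∈ P := hw' _ (hmono hff' ⟨C, hC, hwC, hwC'⟩) hwu hwv
  obtain ⟨D, hD, hD1, hD2⟩ := hub
  -- Since u ≤ w' ≤ w, also w' is bounded by f; minimality of w then gives w ≤ w' ≤ z.
  have hwb' : w' ∈ boundedBy P f := by
    refine ⟨C + D, add_nonneg hC hD, ?_, ?_⟩
    · have : w' + (C + D) • f = (w' - u.1) + (u.1 + D • f) + C • f := by module
      rw [this]; exact hadd _ (hadd _ hwu' _ hD1) _ (hsmul C hC _ hfP)
    · have : (C + D) • f - w' = (w - w') + (C • f - w) + D • f := by module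
      rw [this]; exact hadd _ (hadd _ h2 _ hwC') _ (hsmul D hD _ hfP)
  have h3 := hw _ hwb' hwu' hwv'
  refine hcone' (p := z - (w, l w)) ?_ (by simp [hzl])
  have : (z - (w, l w)).1 = (z.1 - w') + (w' - w) := by simp
  rw [this]; exact hadd _ h1 _ h3

end OrderTheory

/-! ### Invariant functionals as operators, and the simplex of invariant states -/

section Functionals

variable {A : Type*} [CStarAlgebra A] {G : Type*} [Group G] (α : G →* (A ≃⋆ₐ[ℂ] A))

/-- The cone of invariant positive functionals. -/
def invariantCone : Set (WeakDual ℂ A) :=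
  {φ | (∀ a, 0 ≤ φ (star a * a)) ∧ ∀ g a, φ (α g a) = φ a}

variable {α}

theorem add_mem_invariantCone {φ ψ : WeakDual ℂ A} (hφ : φ ∈ invariantCone α)
    (hψ : ψ ∈ invariantCone α) : φ + ψ ∈ invariantCone α :=
  ⟨fun a => add_nonneg (hφ.1 a) (hψ.1 a), fun g a => congrArg₂ (· + ·) (hφ.2 g a) (hψ.2 g a)⟩

theorem weakDual_real_smul_apply (c : ℝ) (φ : WeakDual ℂ A) (a : A) :
    (c • φ) a = (c : ℂ) * φ a := rfl

theorem weakDual_add_apply (φ ψ : WeakDual ℂ A) (a : A) : (φ + ψ) a = φ a + ψ a := rfl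

theorem weakDual_sub_apply (φ ψ : WeakDual ℂ A) (a : A) : (φ - ψ) a = φ a - ψ a := rfl

theorem smul_mem_invariantCone {c : ℝ} (hc : 0 ≤ c) {φ : WeakDual ℂ A}
    (hφ : φ ∈ invariantCone α) : c • φ ∈ invariantCone α :=
  ⟨fun a => mul_nonneg (Complex.zero_le_real.mpr hc) (hφ.1 a), fun g a => by
    rw [weakDual_real_smul_apply, weakDual_real_smul_apply, hφ.2]⟩

theorem convex_invariantStates : Convex ℝ (invariantStates α) := by
  rintro φ ⟨h1, h2, h3⟩ ψ ⟨k1, k2, k3⟩ s t hs ht hst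
  have := add_mem_invariantCone (smul_mem_invariantCone hs (α := α) ⟨h2, h3⟩)
    (smul_mem_invariantCone ht ⟨k2, k3⟩)
  refine ⟨?_, this.1, this.2⟩
  rw [weakDual_add_apply, weakDual_real_smul_apply, weakDual_real_smul_apply, h1, k1, mul_one,
    mul_one, ← Complex.ofReal_add, hst, Complex.ofReal_one]

variable (A) in
/-- The real part of the value of a functional at the unit. -/
def evalOneRe : WeakDual ℂ A →ₗ[ℝ] ℝ where
  toFun φ := (φ 1).re
  map_add' φ ψ := by rw [weakDual_add_apply, Complex.add_re]
  map_smul' c φ := by rw [weakDual_real_smul_apply, Complex.re_ofReal_mul]; rfl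

theorem evalOneRe_apply (φ : WeakDual ℂ A) : evalOneRe A φ = (φ 1).re := rfl

variable [PartialOrder A] [StarOrderedRing A]

/-- The order-theoretic positive functional given by `φ` with `φ (star a * a) ≥ 0`. -/
def toPositiveLinearMap (φ : WeakDual ℂ A) (hφ : ∀ a, 0 ≤ φ (star a * a)) : A →ₚ[ℂ] ℂ :=
  PositiveLinearMap.mk₀ (WeakDual.toStrongDual φ).toLinearMap fun x hx => by
    obtain ⟨b, rfl⟩ := CStarAlgebra.nonneg_iff_eq_star_mul_self.mp hx
    exact hφ b

theorem toPositiveLinearMap_apply (φ : WeakDual ℂ A) (hφ : ∀ a, 0 ≤ φ (star a * a)) (a : A) :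
    toPositiveLinearMap φ hφ a = φ a := rfl

theorem norm_gnsVec_sq (f : A →ₚ[ℂ] ℂ) (a : A) : (‖gnsVec f a‖ : ℂ) ^ 2 = f (star a * a) := by
  rw [← inner_gnsVec, inner_self_eq_norm_sq_to_K]; rfl

/-- Cauchy–Schwarz for the vector functional of Ω. It puts the states in the unit ball and shows
that a positive functional vanishing at 1 is zero. -/
theorem norm_apply_le (f : A →ₚ[ℂ] ℂ) (a : A) : ‖f a‖ ≤ ‖gnsVec f 1‖ ^ 2 * ‖a‖ := by
  have h1 : f a = ⟪gnsVec f 1, gnsVec f a⟫_ℂ := by rw [inner_gnsVec, star_one, one_mul]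
  rw [h1]
  refine (norm_inner_le_norm _ _).trans ?_
  rw [sq, mul_assoc]
  gcongr
  rw [gnsVec_eq, mul_comm]
  exact norm_gnsStarAlgHom_apply_le f a _

theorem norm_gnsVec_one_sq (f : A →ₚ[ℂ] ℂ) : ‖gnsVec f 1‖ ^ 2 = (f 1).re := by
  have := congrArg Complex.re (norm_gnsVec_sq f 1)
  rw [star_one, one_mul] at this
  rw [← this, ← Complex.ofReal_pow, Complex.ofReal_re]

/-- The operator `T` on the GNS space of `f` represents the functional `φ`. -/
def Represents (f : A →ₚ[ℂ] ℂ) (T : f.GNS →L[ℂ] f.GNS) (φ : WeakDual ℂ A) : Prop :=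
  ∀ a b, ⟪gnsVec f a, T (gnsVec f b)⟫_ℂ = φ (star a * b)

variable {f : A →ₚ[ℂ] ℂ} {S T : f.GNS →L[ℂ] f.GNS} {φ ψ : WeakDual ℂ A}

theorem Represents.add (hS : Represents f S φ) (hT : Represents f T ψ) :
    Represents f (S + T) (φ + ψ) := fun a b => by
  rw [add_apply, inner_add_right, hS, hT]; rfl

theorem Represents.sub (hS : Represents f S φ) (hT : Represents f T ψ) :
    Represents f (S - T) (φ - ψ) := fun a b => by
  rw [sub_apply, inner_sub_right, hS, hT]; rfl

theorem Represents.smul (hS : Represents f S φ) (c : ℝ) :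
    Represents f (c • S) (c • φ) := fun a b => by
  rw [← Complex.coe_smul, smul_apply, inner_smul_right, hS]; rfl

theorem represents_one (hφ : ∀ a, φ a = f a) : Represents f 1 φ := fun a b => by
  rw [one_apply_eq_self, inner_gnsVec, hφ]

theorem Represents.nonneg_iff (hT : Represents f T φ) :
    0 ≤ T ↔ ∀ a, 0 ≤ φ (star a * a) := by
  rw [ContinuousLinearMap.nonneg_iff_isPositive]
  constructor
  · intro h a
    rw [← hT]
    exact h.inner_nonneg_right _
  · intro h
    have hx : ∀ x, 0 ≤ ⟪T x, x⟫_ℂ := by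
      intro x
      refine (denseRange_gnsVec f).induction_on (p := fun x => 0 ≤ ⟪T x, x⟫_ℂ) x ?_ ?_
      · exact isClosed_le continuous_const (by fun_prop)
      · intro a
        rw [← inner_conj_symm, hT, ← Complex.star_def, star_nonneg_iff]
        exact h a
    rw [ContinuousLinearMap.isPositive_iff_complex]
    intro x
    have := hx x
    rw [Complex.nonneg_iff] at this
    exact ⟨Complex.ext rfl this.2, this.1⟩

/-- Radon–Nikodym: by domination the identity of A induces a bounded map J from the GNS space of f
to that of φ, and T = J⋆J. -/
theorem exists_represents {C : ℝ} (hC : 0 ≤ C) (hφ : ∀ a, 0 ≤ φ (star a * a))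
    (hle : ∀ a, φ (star a * a) ≤ C * f (star a * a)) : ∃ T, Represents f T φ := by
  set p := toPositiveLinearMap φ hφ
  have hbound : ∀ x : f.PreGNS, ‖(p.toPreGNS.toLinearMap ∘ₗ f.ofPreGNS.toLinearMap) x‖ ≤
      √C * ‖x‖ := fun x => by
    change ‖p.toPreGNS (f.ofPreGNS x)‖ ≤ √C * ‖x‖
    rw [p.preGNS_norm_def, f.preGNS_norm_def, ← Real.sqrt_mul hC]
    refine Real.sqrt_le_sqrt ?_
    have := (Complex.le_def.mp (hle (f.ofPreGNS x))).1
    rwa [Complex.re_ofReal_mul] at this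
  let J : f.GNS →L[ℂ] p.GNS := (LinearMap.mkContinuous _ _ hbound).completion
  have hJ : ∀ a, J (gnsVec f a) = gnsVec p a := fun a =>
    ContinuousLinearMap.completion_apply_coe _ _
  refine ⟨ContinuousLinearMap.adjoint J ∘L J, fun a b => ?_⟩
  rw [ContinuousLinearMap.comp_apply, ContinuousLinearMap.adjoint_inner_right, hJ, hJ,
    inner_gnsVec]
  rfl

variable {h : ∀ g a, f (α g a) = f a}

theorem Represents.memCovariantCommutant (hT : Represents f T φ)
    (hφ : ∀ g a, φ (α g a) = φ a) : MemCovariantCommutant h T where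
  hom c := gns_clm_ext_inner fun a b => by
    rw [mul_apply_eq_comp, mul_apply_eq_comp, gnsStarAlgHom_gnsVec, hT, inner_gnsStarAlgHom_right,
      gnsStarAlgHom_gnsVec, hT, star_mul, star_star, mul_assoc]
  imp g := gns_clm_ext_inner fun a b => by
    obtain ⟨a, rfl⟩ := EquivLike.surjective (α g) a
    rw [mul_apply_eq_comp, mul_apply_eq_comp, gnsImplementer_gnsVec, hT,
      ← gnsImplementer_gnsVec f (α g) (h g) a, inner_gnsImplementer, hT, ← map_star, ← map_mul, hφ]

/-- The functional is a ↦ ⟪Ω, T π(a) Ω⟫: commuting with π makes it represented by T, and commuting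
with the implementers makes it invariant. -/
theorem MemCovariantCommutant.exists_represents (hT : MemCovariantCommutant h T) :
    ∃ φ : WeakDual ℂ A, Represents f T φ ∧ ∀ g a, φ (α g a) = φ a := by
  refine ⟨StrongDual.toWeakDual ((innerSL ℂ (gnsVec f 1)).comp
    (T.comp ⟨gnsVec f, continuous_gnsVec f⟩)), fun a b => ?_, fun g a => ?_⟩
  · change _ = ⟪gnsVec f 1, T (gnsVec f (star a * b))⟫_ℂ
    have h1 := DFunLike.congr_fun (hT.hom (star a)).eq (gnsVec f b)
    rw [mul_apply_eq_comp, mul_apply_eq_comp, gnsStarAlgHom_gnsVec] at h1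
    rw [h1, inner_gnsStarAlgHom_right, gnsStarAlgHom_gnsVec, star_star, mul_one]
  · change ⟪gnsVec f 1, T (gnsVec f (α g a))⟫_ℂ = ⟪gnsVec f 1, T (gnsVec f a)⟫_ℂ
    have h1 := DFunLike.congr_fun (hT.imp g).eq (gnsVec f a)
    rw [mul_apply_eq_comp, mul_apply_eq_comp, gnsImplementer_gnsVec] at h1
    rw [h1, ← inner_gnsImplementer f (α g) (h g) (gnsVec f 1) (T (gnsVec f a)),
      gnsImplementer_gnsVec, map_one (α g)]

theorem Represents.nonneg_iff_mem (hT : Represents f T φ) (hφ : ∀ g a, φ (α g a) = φ a) :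
    0 ≤ T ↔ φ ∈ invariantCone α := by
  rw [hT.nonneg_iff]
  exact ⟨fun h => ⟨h, hφ⟩, fun h => h.1⟩

theorem exists_represents_of_boundedBy {F : WeakDual ℂ A} (hF : F ∈ invariantCone α)
    (hφ : φ ∈ boundedBy (invariantCone α) F) :
    ∃ T, Represents (toPositiveLinearMap F hF.1) T φ ∧ IsSelfAdjoint T := by
  obtain ⟨C, hC, h1, h2⟩ := hφ
  have hone : Represents (toPositiveLinearMap F hF.1) 1 F := represents_one fun _ => rfl
  -- Shifting by C • F makes φ positive, and φ ≤ C • F bounds the shift by 2C • F; the shift is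
  -- undone by subtracting C • 1.
  obtain ⟨T, hT⟩ := exists_represents (f := toPositiveLinearMap F hF.1) (φ := φ + C • F)
    (C := 2 * C) (by positivity) h1.1 fun a => by
      have := h2.1 a
      rw [weakDual_sub_apply, sub_nonneg, weakDual_real_smul_apply] at this
      rw [weakDual_add_apply, weakDual_real_smul_apply, toPositiveLinearMap_apply,
        Complex.ofReal_mul, Complex.ofReal_ofNat, mul_assoc, two_mul]
      gcongr
  refine ⟨T - C • 1, ?_, ?_⟩
  · have := hT.sub (hone.smul C)
    rwa [add_sub_cancel_right] at this
  · refine (hT.nonneg_iff.mpr h1.1).isSelfAdjoint.sub ?_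
    exact (IsSelfAdjoint.all C).smul (.one _)

/-- Representation by operators preserves and reflects order. The operators involved commute, so
`cfcSup` is their supremum, and it lies in the commutant again, hence represents an invariant
functional. -/
theorem exists_sup_boundedBy {g : ℕ → G} (hg : IsAsymptoticallyAbelianAlong α g)
    {F : WeakDual ℂ A} (hF : F ∈ invariantCone α) {u v : WeakDual ℂ A}
    (hu : u ∈ boundedBy (invariantCone α) F) (hv : v ∈ boundedBy (invariantCone α) F) :
    ∃ w ∈ boundedBy (invariantCone α) F, w - u ∈ invariantCone α ∧ w - v ∈ invariantCone α ∧
      ∀ z ∈ boundedBy (invariantCone α) F, z - u ∈ invariantCone α → z - v ∈ invariantCone α →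
        z - w ∈ invariantCone α := by
  obtain ⟨f, hFf, hrep⟩ : ∃ f : A →ₚ[ℂ] ℂ, (∀ a, F a = f a) ∧
      ∀ {φ}, φ ∈ boundedBy (invariantCone α) F → ∃ T, Represents f T φ ∧ IsSelfAdjoint T :=
    ⟨toPositiveLinearMap F hF.1, fun _ => rfl, exists_represents_of_boundedBy hF⟩
  have h : ∀ g a, f (α g a) = f a := fun g a => by
    rw [← hFf, ← hFf, hF.2]
  have hone : Represents f 1 F := represents_one hFf
  have hinv : ∀ {x : WeakDual ℂ A}, x ∈ boundedBy (invariantCone α) F →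
      ∀ g a, x (α g a) = x a := by
    rintro x ⟨C, hC, h1, -⟩ g a
    have := h1.2 g a
    rw [weakDual_add_apply, weakDual_add_apply, weakDual_real_smul_apply,
      weakDual_real_smul_apply, hF.2] at this
    exact add_right_cancel this
  have hinvsub : ∀ {x y : WeakDual ℂ A}, (∀ g a, x (α g a) = x a) → (∀ g a, y (α g a) = y a) →
      ∀ g a, (x - y) (α g a) = (x - y) a := fun hx hy g a => by
    rw [weakDual_sub_apply, weakDual_sub_apply, hx, hy]
  have hcomm : ∀ {S T : f.GNS →L[ℂ] f.GNS} (hS : MemCovariantCommutant h S)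
      (hSa : IsSelfAdjoint S) (hT : MemCovariantCommutant h T) (hTa : IsSelfAdjoint T),
      Commute S T := MemCovariantCommutant.commute (commute_compressions h hg)
  obtain ⟨S, hS, hSa⟩ := hrep hu
  obtain ⟨T, hT, hTa⟩ := hrep hv
  have hSm : MemCovariantCommutant h S := hS.memCovariantCommutant (hinv hu)
  have hTm : MemCovariantCommutant h T := hT.memCovariantCommutant (hinv hv)
  have hRm : MemCovariantCommutant h (cfcSup S T) :=
    ⟨fun a => commute_cfcSup hSa hTa (hSm.hom a) (hTm.hom a),
      fun g => commute_cfcSup hSa hTa (hSm.imp g) (hTm.imp g)⟩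
  obtain ⟨w, hw, hwi⟩ := hRm.exists_represents
  have hwS := sub_cfcSup_left S T hSa hTa
  have hwT : 0 ≤ cfcSup S T - T := cfcSup_comm S T ▸ sub_cfcSup_left T S hTa hSa
  have hwu := ((hw.sub hS).nonneg_iff_mem (hinvsub hwi (hinv hu))).mp hwS
  refine ⟨w, ?_, hwu,
    ((hw.sub hT).nonneg_iff_mem (hinvsub hwi (hinv hv))).mp hwT, fun z hz hzu hzv => ?_⟩
  · have hRa : IsSelfAdjoint (cfcSup S T) := by
      simpa using hwS.isSelfAdjoint.add hSa
    have hFi : ∀ g a, (‖cfcSup S T‖ • F) (α g a) = (‖cfcSup S T‖ • F) a := fun g a => by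
      rw [weakDual_real_smul_apply, weakDual_real_smul_apply, hF.2]
    -- A self-adjoint R satisfies -‖R‖ ≤ R ≤ ‖R‖, and the identity operator represents F.
    refine ⟨‖cfcSup S T‖, norm_nonneg _, ?_, ?_⟩
    · refine ((hw.add (hone.smul ‖cfcSup S T‖)).nonneg_iff_mem fun g a => ?_).mp ?_
      · rw [weakDual_add_apply, weakDual_add_apply, hwi, hFi]
      · have := hRa.neg_algebraMap_norm_le_self
        rwa [neg_le_iff_add_nonneg', add_comm, Algebra.algebraMap_eq_smul_one] at this
    · refine (((hone.smul ‖cfcSup S T‖).sub hw).nonneg_iff_mem (hinvsub hFi hwi)).mp ?_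
      have := hRa.le_algebraMap_norm_self
      rwa [← sub_nonneg, Algebra.algebraMap_eq_smul_one] at this
  · obtain ⟨Z, hZ, hZa⟩ := hrep hz
    have hZm : MemCovariantCommutant h Z := hZ.memCovariantCommutant (hinv hz)
    refine ((hZ.sub hw).nonneg_iff_mem (hinvsub (hinv hz) hwi)).mp ?_
    exact cfcSup_le (hcomm hZm hZa hSm hSa) (hcomm hZm hZa hTm hTa) (hcomm hSm hSa hTm hTa)
      ((hZ.sub hS).nonneg_iff.mpr hzu.1) ((hZ.sub hT).nonneg_iff.mpr hzv.1)

theorem isCompact_invariantStates : IsCompact (invariantStates α) := by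
  refine (WeakDual.isCompact_closedBall 0 1).of_isClosed_subset ?_ ?_
  · have h1 : invariantStates α = {φ : WeakDual ℂ A | φ 1 = 1} ∩
        ((⋂ a, {φ : WeakDual ℂ A | 0 ≤ φ (star a * a)}) ∩
          ⋂ g, ⋂ a, {φ : WeakDual ℂ A | φ (α g a) = φ a}) := by
      ext φ
      simp [invariantStates]
    rw [h1]
    refine (isClosed_eq (WeakDual.eval_continuous _) continuous_const).inter
      ((isClosed_iInter fun a => isClosed_le continuous_const (WeakDual.eval_continuous _)).inter
      (isClosed_iInter fun g => isClosed_iInter fun a =>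
        isClosed_eq (WeakDual.eval_continuous _) (WeakDual.eval_continuous _)))
  · rintro φ ⟨h1, h2, -⟩
    rw [Set.mem_preimage, mem_closedBall_zero_iff]
    refine ContinuousLinearMap.opNorm_le_bound _ zero_le_one fun a => ?_
    have := norm_apply_le (toPositiveLinearMap φ h2) a
    rwa [norm_gnsVec_one_sq, toPositiveLinearMap_apply, toPositiveLinearMap_apply, h1,
      Complex.one_re] at this

theorem IsAsymptoticallyAbelianAlong.isChoquetSimplex {g : ℕ → G}
    (hg : IsAsymptoticallyAbelianAlong α g) : IsChoquetSimplex (invariantStates α) := by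
  have hone : ∀ φ ∈ invariantCone α, 0 ≤ φ 1 := fun φ hφ => by simpa using hφ.1 1
  refine ⟨isCompact_invariantStates, convex_invariantStates,
    exists_sup_coneDiff (P := invariantCone α) (l := evalOneRe A)
      (fun _ hx _ hy => add_mem_invariantCone hx hy) (fun _ hc _ hx => smul_mem_invariantCone hc hx)
      (fun φ hφ => (Complex.nonneg_iff.mp (hone φ hφ)).1) (fun φ hφ h0 => ?_) (fun φ => ?_)
      (fun F hF u hu v hv => exists_sup_boundedBy hg hF hu hv)⟩
  · refine DFunLike.ext φ 0 fun a => ?_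
    have := norm_apply_le (toPositiveLinearMap φ hφ.1) a
    rw [norm_gnsVec_one_sq, toPositiveLinearMap_apply, toPositiveLinearMap_apply,
      ← evalOneRe_apply, h0, zero_mul] at this
    exact norm_le_zero_iff.mp this
  · constructor
    · rintro ⟨h1, h2, h3⟩
      exact ⟨⟨h2, h3⟩, by rw [evalOneRe_apply, h1, Complex.one_re]⟩
    · rintro ⟨hφ, h1⟩
      -- Positivity already makes φ 1 real, so its real part determines it.
      exact ⟨Complex.ext h1 (Complex.nonneg_iff.mp (hone φ hφ)).2.symm, hφ.1, hφ.2⟩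

end Functionals

/-! ### Passing commutation to the norm closure -/

section Density

variable {B : Type*} [CStarAlgebra B]

/-- Eventual commutation on a set implies asymptotic commutation in norm on its closure. -/
theorem tendsto_norm_commutator_of_mem_closure {ρ : ℕ → B →⋆ₐ[ℂ] B} {s : Set B}
    (hs : ∀ a ∈ s, ∀ b ∈ s, ∀ᶠ n in atTop, Commute (ρ n a) b) {a b : B} (ha : a ∈ closure s)
    (hb : b ∈ closure s) : Tendsto (fun n => ‖ρ n a * b - b * ρ n a‖) atTop (𝓝 0) := by
  have hρ : ∀ n x, ‖ρ n x‖ ≤ ‖x‖ := fun n x => NonUnitalStarAlgHom.norm_apply_le (ρ n) x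
  have hcomm : ∀ x y : B, ‖x * y - y * x‖ ≤ 2 * (‖x‖ * ‖y‖) := fun x y => by
    refine (norm_sub_le _ _).trans ?_
    have h1 := norm_mul_le x y
    have h2 := norm_mul_le y x
    linarith
  rw [Metric.tendsto_atTop']
  intro ε hε
  -- The error is at most 2‖a - a'‖‖b‖ + 2‖a'‖‖b - b'‖, half of ε for each term; a' comes first
  -- because the tolerance for b' depends on ‖a'‖.
  obtain ⟨a', ha', hda⟩ := Metric.mem_closure_iff.mp ha (ε / (4 * (‖b‖ + 1))) (by positivity)
  obtain ⟨b', hb', hdb⟩ := Metric.mem_closure_iff.mp hb (ε / (4 * (‖a'‖ + 1))) (by positivity)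
  rw [dist_eq_norm, lt_div_iff₀ (by positivity)] at hda hdb
  obtain ⟨N, hN⟩ := eventually_atTop.mp (hs a' ha' b' hb')
  refine ⟨N, fun n hn => ?_⟩
  have hsplit : ρ n a * b - b * ρ n a = (ρ n (a - a') * b - b * ρ n (a - a')) +
      (ρ n a' * (b - b') - (b - b') * ρ n a') := by
    have := (hN n hn.le).eq
    rw [map_sub, sub_mul, mul_sub, mul_sub, sub_mul, this]
    abel
  rw [dist_zero_right, norm_norm, hsplit]
  have h1 := hcomm (ρ n (a - a')) b
  have h2 := hcomm (ρ n a') (b - b')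
  have h3 := mul_le_mul_of_nonneg_right (hρ n (a - a')) (norm_nonneg b)
  have h4 := mul_le_mul_of_nonneg_right (hρ n a') (norm_nonneg (b - b'))
  have h5 := norm_add_le (ρ n (a - a') * b - b * ρ n (a - a'))
    (ρ n a' * (b - b') - (b - b') * ρ n a')
  nlinarith [norm_nonneg (a - a'), norm_nonneg (b - b')]

end Density

/-! ### The permutations move finite blocks off themselves -/

section Swap

theorem finite_swapPerm_ne (n : ℕ) : {k | swapPerm n k ≠ k}.Finite := by
  refine (Set.finite_Icc (-2 ^ (n + 1) : ℤ) (2 ^ (n + 1))).subset fun k hk => ?_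
  rw [Set.mem_Icc, ← abs_le]
  by_contra h
  exact hk (swapFun_eq_self n k (not_le.mp h))

/-- Each half of the block is translated outward by its own length. The index is shifted by one:
`swapFun n` is g_{n+1}. -/
theorem le_abs_swapFun {n : ℕ} {k : ℤ} (hk : |k| < 2 ^ n) : 2 ^ n ≤ |swapFun n k| := by
  unfold swapFun
  rw [pow_succ]
  generalize (2 : ℤ) ^ n = m at *
  grind

theorem eventually_abs_lt_two_pow (k : ℤ) : ∀ᶠ n : ℕ in atTop, |k| < 2 ^ n :=
  (tendsto_pow_atTop_atTop_of_one_lt (one_lt_two (α := ℤ))).eventually_gt_atTop _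

variable {H : Type u} [NormedAddCommGroup H] [InnerProductSpace ℂ H] [CompleteSpace H]
  (e : HilbertBasis ℤ ℂ H)

/-- For basis vectors, e (swapFun n i) leaves every block containing j; sesquilinearity does the
rest, as x and y involve finitely many of them. -/
theorem eventually_inner_swapUnitary_eq_zero {x y : H} (hx : x ∈ finSpan e)
    (hy : y ∈ finSpan e) :
    ∀ᶠ n in atTop, ⟪y, (swapUnitary e n : H ≃ₗᵢ[ℂ] H) x⟫_ℂ = 0 := by
  induction hx using Submodule.span_induction with
  | mem x hx =>
    obtain ⟨i, rfl⟩ := hx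
    induction hy using Submodule.span_induction with
    | mem y hy =>
      obtain ⟨j, rfl⟩ := hy
      filter_upwards [eventually_abs_lt_two_pow i, eventually_abs_lt_two_pow j] with n hi hj
      have h1 : (swapUnitary e n : H ≃ₗᵢ[ℂ] H) (e i) = e (swapFun n i) :=
        permUnitary_apply e (swapPerm n) i
      rw [h1, orthonormal_iff_ite.mp e.orthonormal, if_neg]
      rintro rfl
      exact absurd hj (not_lt.mpr (le_abs_swapFun hi))
    | zero => simp
    | add y z _ _ hy hz =>
      filter_upwards [hy, hz] with n h1 h2
      rw [inner_add_left, h1, h2, add_zero]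
    | smul c y _ hy =>
      filter_upwards [hy] with n h1
      rw [inner_smul_left, h1, mul_zero]
  | zero => simp
  | add x z _ _ hx hz =>
    filter_upwards [hx, hz] with n h1 h2
    rw [map_add, inner_add_right, h1, h2, add_zero]
  | smul c x _ hx =>
    filter_upwards [hx] with n h1
    rw [map_smul, inner_smul_right, h1, mul_zero]

end Swap

/-! ### Asymptotic abelianness of the CCR system -/

section CCRModel

variable {H : Type u} [NormedAddCommGroup H] [InnerProductSpace ℂ H]

theorem commute_W_of_inner_eq_zero {x y : H} (h : ⟪y, x⟫_ℂ = 0) :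
    Commute (CCR.W (symplecticForm H) x) (CCR.W (symplecticForm H) y) := by
  have h1 : symplecticForm H x y = 0 := by
    change (⟪y, x⟫_ℂ).im = 0
    rw [h, Complex.zero_im]
  have h2 : symplecticForm H y x = 0 := by
    change (⟪x, y⟫_ℂ).im = 0
    rw [← inner_conj_symm, h, map_zero, Complex.zero_im]
  rw [Commute, SemiconjBy, CCR.W_mul_W, CCR.W_mul_W, h1, h2, add_comm]

variable [CompleteSpace H] (e : HilbertBasis ℤ ℂ H)

theorem eventually_commute_W_swapUnitary {x : H} (hx : x ∈ finSpan e)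
    {b : CCR (symplecticForm H)}
    (hb : b ∈ StarAlgebra.adjoin ℂ (CCR.W (symplecticForm H) '' (finSpan e : Set H))) :
    ∀ᶠ n in atTop, Commute (CCR.W (symplecticForm H) ((swapUnitary e n : H ≃ₗᵢ[ℂ] H) x)) b := by
  induction hb using StarAlgebra.adjoin_induction generalizing x with
  | mem b hb =>
    obtain ⟨y, hy, rfl⟩ := hb
    filter_upwards [eventually_inner_swapUnitary_eq_zero e hx hy] with n hn
    exact commute_W_of_inner_eq_zero hn
  | algebraMap r => exact .of_forall fun n => (Algebra.commutes r _).symm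
  | add b c _ _ hb hc =>
    filter_upwards [hb hx, hc hx] with n h1 h2
    exact h1.add_right h2
  | mul b c _ _ hb hc =>
    filter_upwards [hb hx, hc hx] with n h1 h2
    exact h1.mul_right h2
  | star b _ hb =>
    -- The adjoint of W(g x) is W(-g x), so the induction hypothesis is needed at -x; hence x is
    -- generalised.
    filter_upwards [hb ((finSpan e).neg_mem hx)] with n h1
    rw [map_neg, ← CCR.star_W] at h1
    have := congrArg star h1.eq
    rw [star_mul, star_mul, star_star] at this
    exact this.symm

theorem eventually_commute_rhoFull_swapUnitary {a b : CCR (symplecticForm H)}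
    (ha : a ∈ StarAlgebra.adjoin ℂ (CCR.W (symplecticForm H) '' (finSpan e : Set H)))
    (hb : b ∈ StarAlgebra.adjoin ℂ (CCR.W (symplecticForm H) '' (finSpan e : Set H))) :
    ∀ᶠ n in atTop, Commute (rhoFull (swapUnitary e n : H ≃ₗᵢ[ℂ] H) a) b := by
  induction ha using StarAlgebra.adjoin_induction generalizing b with
  | mem a ha =>
    obtain ⟨x, hx, rfl⟩ := ha
    exact eventually_commute_W_swapUnitary e hx hb
  | algebraMap r =>
    refine .of_forall fun n => ?_
    rw [AlgHomClass.commutes]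
    exact Algebra.commutes r b
  | add a c _ _ ha hc =>
    filter_upwards [ha hb, hc hb] with n h1 h2
    rw [map_add]
    exact h1.add_left h2
  | mul a c _ _ ha hc =>
    filter_upwards [ha hb, hc hb] with n h1 h2
    rw [map_mul]
    exact h1.mul_left h2
  | star a _ ha =>
    filter_upwards [ha (star_mem hb)] with n h1
    have := congrArg star h1.eq
    rw [star_mul, star_mul, star_star] at this
    rw [map_star]
    exact this.symm

/-- The estimate may be made in the whole CCR algebra: B₀ is the closure there of the generated
⋆-algebra, with the inherited norm, and `rho` restricts `rhoFull`. -/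
theorem isAsymptoticallyAbelianAlong_swapUnitary :
    IsAsymptoticallyAbelianAlong (rho e) (swapUnitary e) := fun a b =>
  tendsto_norm_commutator_of_mem_closure
    (ρ := fun n => rhoFull (swapUnitary e n : H ≃ₗᵢ[ℂ] H))
    (s := StarAlgebra.adjoin ℂ (CCR.W (symplecticForm H) '' (finSpan e : Set H)))
    (fun _ ha _ hb => eventually_commute_rhoFull_swapUnitary e ha hb) a.2 b.2

end CCRModel

end
theorem lemma3p1 {H : Type*} [NormedAddCommGroup H] [InnerProductSpace ℂ H] [CompleteSpace H]
    (e : HilbertBasis ℤ ℂ H) :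
    (∀ n, {k | swapPerm n k ≠ k}.Finite) ∧
    IsAsymptoticallyAbelianAlong (rho e) (swapUnitary e) ∧
    IsAsymptoticallyAbelian (rho e) ∧
    IsGAbelian (rho e) ∧
    IsChoquetSimplex (invariantStates (rho e)) := by
  have h := isAsymptoticallyAbelianAlong_swapUnitary e
  exact ⟨finite_swapPerm_ne, h, ⟨_, h⟩, h.isGAbelian, h.isChoquetSimplex⟩
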